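/- Let $K$ be a non-archimedean local field with ring of integers $\mathcal{O}_K$, and let $B$ be a finite-dimensional central division algebra over $K$, with ring of integers $\mathcal{O}_B$ and uniformizer $\pi_B$. An order in $\mathbb{M}_2(B)$ is an $\mathcal{O}_K$-subalgebra (containing $1$) that is finitely generated as an $\mathcal{O}_K$-module; a maximal order is an order spanning $\mathbb{M}_2(B)$ over $K$ that is maximal for inclusion among such orders. Let $\mathfrak{T}(B)$ be the Bruhat–Tits tree of $\mathbb{M}_2(B)$: its vertices are the maximal orders in $\mathbb{M}_2(B)$, and two distinct maximal orders are neighbors if they are the endomorphism rings $\mathrm{End}_{\mathcal{O}_B}(\Lambda)$, $\mathrm{End}_{\mathcal{O}_B}(\Lambda')$ of right $\mathcal{O}_B$-lattices $\Lambda,\Lambda'\subseteq B^2$ with $\Lambda\pi_B\subsetneq\Lambda'\subsetneq\Lambda$. For an order $\mathfrak{H}$, the branch $\mathfrak{S}(\mathfrak{H})$ is the maximal subgraph of $\mathfrak{T}(B)$ whose vertices are the maximal orders containing $\mathfrak{H}$; a subgraph of this form is called an admissible branch. Let $\mathfrak{D}$ be a maximal order in $\mathbb{M}_2(B)$ and let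 $t\geq 0$ be an integer. Then $\mathfrak{D}$ has a unique maximal two-sided ideal $\mathcal{M}_{\mathfrak{D}}$. Let $\mathfrak{B}$ be the ball of radius $t$ in $\mathfrak{T}(B)$ centered at $\mathfrak{D}$, i.e. the largest subgraph containing no vertex at distance larger than $t$ from $\mathfrak{D}$. Then $\mathfrak{B}$ is an admissible branch, and the intersection of all the maximal orders that are vertices of $\mathfrak{B}$ is $$\bigcap_{\mathfrak{D}'\in V(\mathfrak{B})}\mathfrak{D}'=\mathfrak{D}^{[t]}:=\{x\in\mathfrak{D}\;:\;\bar{x}\in Z(\mathfrak{D}/\mathcal{M}_{\mathfrak{D}}^t)\},$$ where $\bar{x}$ is the image of $x$ in $\mathfrak{D}/\mathcal{M}_{\mathfrak{D}}^t$ and $Z(R)$ denotes the center of the ring $R$ (with $\mathcal{M}_{\mathfrak{D}}^0=\mathfrak{D}$). -/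

import Mathlib

open scoped ValuativeRel

namespace BTTree

section Algebra

variable (K : Type*) [Field K] [ValuativeRel K] (B : Type*) [DivisionRing B] [Algebra K B]

/-- The ring of integers of the division algebra `B`: the elements integral over `𝒪[K]`. -/
def integers : Set B := {b | IsIntegral 𝒪[K] b}

/-- The maximal ideal `𝔪_B` of the ring of integers of `B`: its non-units. -/
def maxIdeal : Set B := {b | b ∈ integers K B ∧ ¬ ∃ c ∈ integers K B, b * c = 1}

variable {K B}

/-- A (not necessarily full) `𝒪[K]`-order in `M₂(B)`: a subring containing `𝒪[K]` that is a finitely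
generated `𝒪[K]`-module. -/
def IsOrder (H : Subalgebra 𝒪[K] (Matrix (Fin 2) (Fin 2) B)) : Prop :=
  (Subalgebra.toSubmodule H).FG

/-- An order of maximal rank: it spans `M₂(B)` over `K`. -/
def IsFullOrder (H : Subalgebra 𝒪[K] (Matrix (Fin 2) (Fin 2) B)) : Prop :=
  IsOrder H ∧ Submodule.span K (H : Set (Matrix (Fin 2) (Fin 2) B)) = ⊤

/-- A maximal order in `M₂(B)`. -/
def IsMaximalOrder (D : Subalgebra 𝒪[K] (Matrix (Fin 2) (Fin 2) B)) : Prop :=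
  Maximal IsFullOrder D

/-- A right lattice over the ring of integers of `B`, in the space `B²` of column vectors, on which
matrices act on the left and the scalars of `B` act on the right. -/
structure IsLattice (L : Submodule 𝒪[K] (Fin 2 → B)) : Prop where
  fg : L.FG
  span_eq_top : Submodule.span K (L : Set (Fin 2 → B)) = ⊤
  mul_mem : ∀ v ∈ L, ∀ b ∈ integers K B, MulOpposite.op b • v ∈ L

/-- `L 𝔪_B`, that is `L π_B` for any uniformizer `π_B` of `B`. -/
noncomputable def latticeMulMaxIdeal (L : Submodule 𝒪[K] (Fin 2 → B)) : Submodule 𝒪[K] (Fin 2 → B) :=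
  Submodule.span 𝒪[K] {w | ∃ v ∈ L, ∃ b ∈ maxIdeal K B, w = MulOpposite.op b • v}

/-- The order `D` is the endomorphism ring of the lattice `L`. -/
def IsEndOf (D : Subalgebra 𝒪[K] (Matrix (Fin 2) (Fin 2) B))
    (L : Submodule 𝒪[K] (Fin 2 → B)) : Prop :=
  ∀ A : Matrix (Fin 2) (Fin 2) B, A ∈ D ↔ ∀ v ∈ L, A.mulVec v ∈ L

variable (K B)

/-- The vertices of the Bruhat–Tits tree: the maximal orders in `M₂(B)`. -/
abbrev Vertex : Type _ :=
  {D : Subalgebra 𝒪[K] (Matrix (Fin 2) (Fin 2) B) // IsMaximalOrder D}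

/-- The Bruhat–Tits tree `𝔗(B)`: two maximal orders are neighbors when they are the endomorphism
rings of two lattices `L`, `L'` with `L π_B ⊊ L' ⊊ L`. -/
def tree : SimpleGraph (Vertex K B) :=
  SimpleGraph.fromRel fun D D' =>
    ∃ L L' : Submodule 𝒪[K] (Fin 2 → B), IsLattice L ∧ IsLattice L' ∧
      IsEndOf D.1 L ∧ IsEndOf D'.1 L' ∧ latticeMulMaxIdeal L < L' ∧ L' < L

variable {K B}

/-- The branch `𝔖(H)`: the maximal subgraph of the tree whose vertices are the maximal orders
containing `H`. -/
def branch (H : Subalgebra 𝒪[K] (Matrix (Fin 2) (Fin 2) B)) : (tree K B).Subgraph :=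
  (⊤ : (tree K B).Subgraph).induce {D | H ≤ D.1}

/-- A subgraph of the tree is an admissible branch if it is the branch of some order. -/
def IsAdmissible (S : (tree K B).Subgraph) : Prop :=
  ∃ H : Subalgebra 𝒪[K] (Matrix (Fin 2) (Fin 2) B), IsOrder H ∧ S = branch H

/-- The intersection of all the maximal orders that are vertices of a subgraph. -/
noncomputable def intersectionOrder (S : (tree K B).Subgraph) :
    Subalgebra 𝒪[K] (Matrix (Fin 2) (Fin 2) B) :=
  ⨅ D ∈ S.verts, D.1

/-- The closed ball of radius `t` about `D`: the largest subgraph of the tree with no vertex at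
distance larger than `t` from `D`. -/
def closedBall (D : Vertex K B) (t : ℕ) : (tree K B).Subgraph :=
  (⊤ : (tree K B).Subgraph).induce {D' | (tree K B).edist D D' ≤ t}

end Algebra

section Bilateral

/-- `I` is a maximal (proper) bilateral ideal of the ring `R`. -/
def IsMaximalBilateral {R : Type*} [Ring R] (I : Ideal R) : Prop :=
  Maximal (fun J : Ideal R => J.IsTwoSided ∧ J ≠ ⊤) I

/-- The intersection of the maximal bilateral ideals of `R`; this is the maximal bilateral ideal
whenever `R` has exactly one. -/
def maximalBilateral (R : Type*) [Ring R] : Ideal R :=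
  sInf {I | IsMaximalBilateral I}

instance maximalBilateral_isTwoSided (R : Type*) [Ring R] : (maximalBilateral R).IsTwoSided where
  mul_mem_of_left b ha := by
    rw [maximalBilateral, Submodule.mem_sInf] at ha ⊢
    intro I hI
    have := hI.1.1
    exact Ideal.mul_mem_right b I (ha I hI)

end Bilateral

variable {K : Type*} [Field K] [ValuativeRel K] {B : Type*} [DivisionRing B] [Algebra K B]

/-- `D^{[t]}`: the elements of `D` whose image in `D / M_D ^ t` is central, where `M_D` is the
maximal bilateral ideal of `D`. -/
def bracket (D : Subalgebra 𝒪[K] (Matrix (Fin 2) (Fin 2) B)) (t : ℕ) :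
    Set (Matrix (Fin 2) (Fin 2) B) :=
  {x | ∃ hx : x ∈ D, Ideal.Quotient.mk (maximalBilateral D ^ t) ⟨x, hx⟩ ∈
    Subring.center (D ⧸ maximalBilateral D ^ t)}

end BTTree

/-!
The norm valuation `x ↦ |N x|` on `B` identifies `𝒪_B` with the elements of valuation at most `1`.
Hence right `𝒪_B`-lattices in `B ^ 2` are free, of the form `g 𝒪_B ^ 2`, and the maximal orders are
the conjugates `g M₂(𝒪_B) g⁻¹`. By the Cartan decomposition every maximal order can be written as
the conjugate by `g k diag(π ^ s, 1)` for some `k ∈ GL₂(𝒪_B)`, and `s` is then its distance to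
`g M₂(𝒪_B) g⁻¹`.

After conjugation, an integral `x` lies in the intersection over the ball exactly when the upper
right entry of `k⁻¹ x k` is divisible by `π ^ t` for all `k ∈ GL₂(𝒪_B)`. Taking for `k` a
transposition and the unipotent matrices, this says that `x` commutes with `M₂(𝒪_B)` modulo `π ^ t`.
Since the only maximal bilateral ideal is generated by `π`, this is the condition defining
`D^{[t]}`. Conversely, this intersection contains `g π ^ t M₂(𝒪_B) g⁻¹`, and the orders containing
the latter are those at distance at most `t`; the ball is therefore the branch of the intersection.
-/

namespace BTTree

open ValuativeRel

section Integral

theorem isIntegral_det {R K n : Type*} [CommRing R] [Field K] [Algebra R K] [Fintype n]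
    [DecidableEq n] {M : Matrix n n K} (hM : IsIntegral R M) : IsIntegral R M.det := by
  let L := AlgebraicClosure K
  let N : Matrix n n L := M.map (algebraMap K L)
  obtain ⟨p, hp, hpN⟩ : IsIntegral R N := hM.map (Algebra.ofId K L).mapMatrix
  suffices h : IsIntegral R N.det from
    (isIntegral_algHom_iff (IsScalarTower.toAlgHom R K L) (algebraMap K L).injective).mp
      (by simpa [N, ← RingHom.mapMatrix_apply, RingHom.map_det] using h)
  rw [Matrix.det_eq_prod_roots_charpoly]
  refine IsIntegral.multiset_prod fun μ hμ => ⟨p, hp, ?_⟩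
  rcases isEmpty_or_nonempty n
  · simp at hμ
  have hspec : μ ∈ spectrum L N :=
    Matrix.mem_spectrum_iff_isRoot_charpoly.mpr (Polynomial.isRoot_of_mem_roots hμ)
  have hroot := spectrum.subset_polynomial_aeval N (p.map (algebraMap R L)) ⟨μ, hspec, rfl⟩
  rw [Polynomial.aeval_map_algebraMap, Polynomial.aeval_def, hpN, spectrum.zero_eq] at hroot
  simpa only [Polynomial.eval_map, Set.mem_singleton_iff] using hroot

theorem isIntegral_norm {R K A : Type*} [CommRing R] [Field K] [Algebra R K] [Ring A] [Algebra K A]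
    [Algebra R A] [IsScalarTower R K A] [FiniteDimensional K A] {x : A} (hx : IsIntegral R x) :
    IsIntegral R (Algebra.norm K x) := by
  rw [Algebra.norm_eq_matrix_det (Module.finBasis K A)]
  exact isIntegral_det (hx.map ((Algebra.leftMulMatrix (Module.finBasis K A)).restrictScalars R))

end Integral

section NormValuation

theorem continuous_norm_comp {K A ι : Type*} [Field K] [TopologicalSpace K] [IsTopologicalRing K]
    [Ring A] [Algebra K A] [FiniteDimensional K A] [Finite ι] (f : (ι → K) →ₗ[K] A) :
    Continuous fun x => Algebra.norm K (f x) := by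
  let b := Module.finBasis K A
  simp_rw [Algebra.norm_eq_matrix_det b]
  exact ((Algebra.leftMulMatrix b).toLinearMap ∘ₗ f).continuous_on_pi.matrix_det

theorem isIntegral_integer_iff {K : Type*} [Field K] [ValuativeRel K] {x : K} :
    IsIntegral 𝒪[K] x ↔ valuation K x ≤ 1 :=
  ⟨(Valuation.integer.integers (valuation K)).mem_of_integral,
    fun h => isIntegral_algebraMap (x := (⟨x, h⟩ : 𝒪[K]))⟩

theorem mem_span_smul_of_valuation_repr_le {K : Type*} [Field K] [ValuativeRel K] {V ι : Type*}
    [AddCommGroup V] [Module K V] [Finite ι] (b : Module.Basis ι K V) {c : K} (hc : c ≠ 0) {x : V}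
    (hx : ∀ i, valuation K (b.repr x i) ≤ valuation K c) :
    x ∈ Submodule.span 𝒪[K] (Set.range fun i => c • b i) := by
  cases nonempty_fintype ι
  rw [← b.sum_repr x]
  refine Submodule.sum_mem _ fun i _ => ?_
  have hmem : valuation K (b.repr x i * c⁻¹) ≤ 1 := by
    rw [map_mul, map_inv₀]
    exact mul_inv_le_one_of_le₀ (hx i) zero_le
  have hsmul : b.repr x i • b i = (⟨b.repr x i * c⁻¹, hmem⟩ : 𝒪[K]) • c • b i := by
    rw [Subring.smul_def, smul_smul, inv_mul_cancel_right₀ hc]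
  rw [hsmul]
  exact Submodule.smul_mem _ _ (Submodule.subset_span ⟨i, rfl⟩)

theorem t2Space (K : Type*) [Field K] [ValuativeRel K] [TopologicalSpace K]
    [IsNonarchimedeanLocalField K] : T2Space K := by
  let := IsTopologicalAddGroup.rightUniformSpace K
  have := isUniformAddGroup_of_addCommGroup (G := K)
  infer_instance

variable {K : Type*} [Field K] [ValuativeRel K] {B : Type*} [DivisionRing B] [Algebra K B]
  [FiniteDimensional K B] [TopologicalSpace K] [IsNonarchimedeanLocalField K]

theorem isCompact_setOf_primitive {ι : Type*} [Finite ι] :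
    IsCompact {x : ι → K | (∀ i, valuation K (x i) ≤ 1) ∧ ∃ i, x i = 1} := by
  have := t2Space K
  have hcube : IsCompact {x : ι → K | ∀ i, valuation K (x i) ≤ 1} := by
    simpa only [Set.pi, Set.mem_univ, forall_const, Set.mem_ofPred_eq] using
      isCompact_univ_pi fun _ : ι => IsNonarchimedeanLocalField.isCompact_closedBall K 1
  have hclosed : IsClosed {x : ι → K | ∃ i, x i = 1} := by
    rw [Set.ofPred_exists]
    exact isClosed_iUnion_of_finite fun i => isClosed_eq (continuous_apply i) continuous_const
  exact hcube.inter_right hclosed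

theorem exists_le_valuation_norm_of_primitive {ι : Type*} [Finite ι] (b : Module.Basis ι K B) :
    ∃ γ : ValueGroupWithZero K, γ ≠ 0 ∧ ∀ x : B, (∀ i, valuation K (b.repr x i) ≤ 1) →
      (∃ i, b.repr x i = 1) → γ ≤ valuation K (Algebra.norm K x) := by
  have := t2Space K
  have hclosed := (isCompact_setOf_primitive (K := K) (ι := ι)).image
    (continuous_norm_comp b.equivFun.symm.toLinearMap) |>.isClosed
  have hzero : (0 : K) ∉ (fun x => Algebra.norm K (b.equivFun.symm x)) ''
      {x : ι → K | (∀ i, valuation K (x i) ≤ 1) ∧ ∃ i, x i = 1} := by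
    rintro ⟨x, ⟨-, i, hi⟩, hx⟩
    obtain rfl : x = 0 := by simpa [Algebra.norm_eq_zero_iff] using hx
    simp at hi
  obtain ⟨γ, hγ, hball⟩ := (IsValuativeTopology.hasBasis_nhds_zero' K).mem_iff.mp
    (hclosed.isOpen_compl.mem_nhds hzero)
  refine ⟨γ, hγ, fun x hx hx1 => not_lt.mp fun hlt => hball hlt ⟨b.equivFun x, ⟨hx, hx1⟩, ?_⟩⟩
  exact congrArg _ (b.equivFun.symm_apply_apply x)

theorem exists_valuation_repr_le {ι : Type*} [Finite ι] (b : Module.Basis ι K B) :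
    ∃ γ : ValueGroupWithZero K, ∀ x : B, valuation K (Algebra.norm K x) ≤ 1 →
      ∀ i, valuation K (b.repr x i) ≤ γ := by
  obtain ⟨γ, hγ, hmin⟩ := exists_le_valuation_norm_of_primitive b
  refine ⟨max 1 γ⁻¹, fun x hx j => ?_⟩
  have : Nonempty ι := ⟨j⟩
  obtain ⟨i, hi⟩ := Finite.exists_max fun i => valuation K (b.repr x i)
  refine (hi j).trans ?_
  set a := b.repr x i
  rcases eq_or_ne a 0 with ha | ha
  · simp [ha]
  have hnorm : γ ≤ valuation K (Algebra.norm K (a⁻¹ • x)) := by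
    refine hmin _ (fun k => ?_) ⟨i, ?_⟩
    · rw [map_smul, Finsupp.smul_apply, smul_eq_mul, map_mul, map_inv₀]
      exact inv_mul_le_one_of_le₀ (hi k) zero_le
    · rw [map_smul, Finsupp.smul_apply, smul_eq_mul, inv_mul_cancel₀ ha]
  have hpow : valuation K a ^ Module.finrank K B ≤ γ⁻¹ := by
    rw [Algebra.smul_def, map_mul, Algebra.norm_algebraMap, map_mul, map_pow, map_inv₀,
      inv_pow] at hnorm
    exact (le_inv_comm₀ (zero_lt_iff.mpr hγ) (by simp [zero_lt_iff, ha])).mp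
      (hnorm.trans (mul_le_of_le_one_right' hx))
  rcases le_total (valuation K a) 1 with h1 | h1
  · exact h1.trans (le_max_left _ _)
  · exact ((le_self_pow₀ h1 Module.finrank_pos.ne').trans hpow).trans (le_max_right _ _)

theorem exists_fg_of_valuation_norm_le_one : ∃ M : Submodule 𝒪[K] B, M.FG ∧
    ∀ x : B, valuation K (Algebra.norm K x) ≤ 1 → x ∈ M := by
  let b := Module.finBasis K B
  obtain ⟨γ, hγ⟩ := exists_valuation_repr_le b
  obtain ⟨c, hc⟩ := valuation_surjective (max 1 γ)
  have hc0 : c ≠ 0 := (valuation K).ne_zero_iff.mp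
    (hc ▸ (zero_lt_one.trans_le (le_max_left 1 γ)).ne')
  exact ⟨_, Submodule.fg_span (Set.finite_range fun i => c • b i), fun x hx =>
    mem_span_smul_of_valuation_repr_le b hc0 fun i => hc ▸ (hγ x hx i).trans (le_max_right 1 γ)⟩

theorem isIntegral_iff_valuation_norm_le_one {x : B} :
    IsIntegral 𝒪[K] x ↔ valuation K (Algebra.norm K x) ≤ 1 := by
  refine ⟨fun hx => isIntegral_integer_iff.mp (isIntegral_norm hx), fun hx => ?_⟩
  obtain ⟨M, hM, hmem⟩ := exists_fg_of_valuation_norm_le_one (K := K) (B := B)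
  have hle : Subalgebra.toSubmodule (Algebra.adjoin 𝒪[K] {x}) ≤ M := by
    rw [Algebra.adjoin_eq_span, Submonoid.closure_singleton_eq, Submodule.span_le]
    rintro _ ⟨k, rfl⟩
    refine hmem _ ?_
    simpa using pow_le_one' hx k.toAdd
  exact IsIntegral.of_mem_of_fg _ (hM.of_le hle) x (Algebra.self_mem_adjoin_singleton _ x)

theorem valuation_norm_add_le_of_le {x y : B}
    (hxy : valuation K (Algebra.norm K y) ≤ valuation K (Algebra.norm K x)) :
    valuation K (Algebra.norm K (x + y)) ≤ valuation K (Algebra.norm K x) := by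
  rcases eq_or_ne x 0 with rfl | hx
  · obtain rfl : y = 0 := by simpa [Algebra.norm_zero, Algebra.norm_eq_zero_iff] using hxy
    rw [add_zero]
  have hadd : x + y = x * (1 + x⁻¹ * y) := by rw [mul_add, mul_one, mul_inv_cancel_left₀ hx]
  have hquot : IsIntegral 𝒪[K] (x⁻¹ * y) := by
    have hpos : 0 < valuation K (Algebra.norm K x) := by
      simpa [zero_lt_iff, Algebra.norm_eq_zero_iff] using hx
    rw [isIntegral_iff_valuation_norm_le_one, ← mul_le_iff_le_one_right hpos, ← map_mul, ← map_mul,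
      mul_inv_cancel_left₀ hx]
    exact hxy
  have hone : IsIntegral 𝒪[K] (1 + x⁻¹ * y) :=
    IsIntegral.of_mem_of_fg _ hquot.fg_adjoin_singleton _
      (add_mem (one_mem _) (Algebra.self_mem_adjoin_singleton _ _))
  rw [hadd, map_mul, map_mul]
  exact mul_le_of_le_one_right' (isIntegral_iff_valuation_norm_le_one.mp hone)

variable (K B) in
/-- The valuation `x ↦ |N(x)|` of the division algebra `B`, with `N` the regular norm; it is a power
of the valuation that extends the one of `K`. -/
noncomputable def normValuation : Valuation B (ValueGroupWithZero K) where
  toFun x := valuation K (Algebra.norm K x)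
  map_zero' := by rw [Algebra.norm_zero, map_zero]
  map_one' := by rw [map_one, map_one]
  map_mul' x y := by rw [map_mul, map_mul]
  map_add_le_max' x y := by
    rcases le_total (valuation K (Algebra.norm K y)) (valuation K (Algebra.norm K x)) with h | h
    · exact (valuation_norm_add_le_of_le h).trans (le_max_left _ _)
    · rw [add_comm]
      exact (valuation_norm_add_le_of_le h).trans (le_max_right _ _)

theorem normValuation_apply (x : B) : normValuation K B x = valuation K (Algebra.norm K x) := rfl

theorem normValuation_algebraMap (c : K) :
    normValuation K B (algebraMap K B c) = valuation K c ^ Module.finrank K B := by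
  rw [normValuation_apply, Algebra.norm_algebraMap, map_pow]

instance : (normValuation K B).IsNontrivial := by
  obtain ⟨r, hr0, hr⟩ := Valuation.IsNontrivial.exists_lt_one (v := valuation K)
  refine ⟨algebraMap K B r, ?_, ?_⟩
  · simpa using hr0
  · rw [normValuation_algebraMap]
    exact (pow_lt_one₀ zero_le hr Module.finrank_pos.ne').ne

theorem exists_smul_normValuation_le_one (b : B) :
    ∃ c : 𝒪[K], c ≠ 0 ∧ normValuation K B (c • b) ≤ 1 := by
  rcases le_or_gt (normValuation K B b) 1 with h | h
  · exact ⟨1, one_ne_zero, by rwa [one_smul]⟩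
  obtain ⟨c, hc⟩ := valuation_surjective (normValuation K B b)⁻¹
  have hb : normValuation K B b ≠ 0 := (zero_lt_one.trans h).ne'
  have hc1 : valuation K c ≤ 1 := hc ▸ inv_le_one_of_one_le₀ h.le
  refine ⟨⟨c, hc1⟩, fun hc0 => inv_ne_zero hb ?_, ?_⟩
  · rw [← hc, show c = 0 from congrArg Subtype.val hc0, map_zero]
  · calc normValuation K B ((⟨c, hc1⟩ : 𝒪[K]) • b)
      _ = valuation K c ^ Module.finrank K B * normValuation K B b := by
        rw [Subring.smul_def, Algebra.smul_def, map_mul, normValuation_algebraMap]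
      _ ≤ valuation K c * normValuation K B b := by
        gcongr
        exact pow_le_of_le_one zero_le hc1 Module.finrank_pos.ne'
      _ = 1 := by rw [hc, inv_mul_cancel₀ hb]

end NormValuation

section IntegerValuation

/-- `v` is a discrete valuation of `B` with uniformizer `π`, whose valuation ring is the ring of
integers of `B` over `𝒪[K]`, contained in a finitely generated `𝒪[K]`-module and spanning `B`
over `K`. -/
structure IsIntegerValuation (K : Type*) [Field K] [ValuativeRel K] {B : Type*} [DivisionRing B]
    [Algebra K B] {Γ : Type*} [LinearOrderedCommGroupWithZero Γ] (v : Valuation B Γ) (π : B) :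
    Prop where
  mem_integers : ∀ b, b ∈ integers K B ↔ v b ≤ 1
  ne_zero : π ≠ 0
  lt_one : v π < 1
  exists_zpow : ∀ b, b ≠ 0 → ∃ k : ℤ, v b = v π ^ k
  exists_fg : ∃ M : Submodule 𝒪[K] B, M.FG ∧ ∀ b, v b ≤ 1 → b ∈ M
  exists_smul : ∀ b, ∃ c : 𝒪[K], c ≠ 0 ∧ v (c • b) ≤ 1

theorem exists_lt_one_forall_eq_zpow {B Γ : Type*} [DivisionRing B]
    [LinearOrderedCommGroupWithZero Γ] [IsCyclic Γˣ] (v : Valuation B Γ) [v.IsNontrivial] :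
    ∃ π, π ≠ 0 ∧ v π < 1 ∧ ∀ b, b ≠ 0 → ∃ k : ℤ, v b = v π ^ k := by
  let f : Bˣ →* Γˣ := Units.map (v : B →* Γ)
  obtain ⟨⟨_, p, rfl⟩, hp⟩ := IsCyclic.exists_generator (α := f.range)
  have hzpow : ∀ b, b ≠ 0 → ∃ k : ℤ, v b = v p ^ k := fun b hb => by
    obtain ⟨k, hk⟩ := hp ⟨f (Units.mk0 b hb), _, rfl⟩
    exact ⟨k, by simpa [f] using (congrArg (fun z : f.range => ((z : Γˣ) : Γ)) hk).symm⟩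
  have hne : v p ≠ 1 := fun h1 => by
    obtain ⟨b, hb0, hb1⟩ := Valuation.IsNontrivial.exists_val_nontrivial (v := v)
    obtain ⟨k, hk⟩ := hzpow b (v.ne_zero_iff.mp hb0)
    exact hb1 (by rw [hk, h1, one_zpow])
  rcases hne.lt_or_gt with hlt | hgt
  · exact ⟨p, p.ne_zero, hlt, hzpow⟩
  · refine ⟨(p : B)⁻¹, inv_ne_zero p.ne_zero, ?_, fun b hb => ?_⟩
    · rw [map_inv₀]
      exact inv_lt_one_of_one_lt₀ hgt
    · obtain ⟨k, hk⟩ := hzpow b hb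
      exact ⟨-k, by rw [hk, map_inv₀, inv_zpow', neg_neg]⟩

theorem exists_isIntegerValuation (K : Type*) [Field K] [ValuativeRel K] (B : Type*)
    [DivisionRing B] [Algebra K B] [FiniteDimensional K B] [TopologicalSpace K]
    [IsNonarchimedeanLocalField K] : ∃ π : B, IsIntegerValuation K (normValuation K B) π := by
  obtain ⟨π, hπ, hlt, hzpow⟩ := exists_lt_one_forall_eq_zpow (normValuation K B)
  exact ⟨π, fun _ => isIntegral_iff_valuation_norm_le_one, hπ, hlt, hzpow,
    exists_fg_of_valuation_norm_le_one, exists_smul_normValuation_le_one⟩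

end IntegerValuation

section EntriesLE

variable {l m n R Γ : Type*} [Ring R] [LinearOrderedCommMonoidWithZero Γ] {v : Valuation R Γ}
  {γ δ ε : Γ}

/-- All the entries of the matrix `x` have valuation at most `γ`; for `γ = 1` this says that `x` is
integral. -/
def EntriesLE (v : Valuation R Γ) (γ : Γ) (x : Matrix m n R) : Prop := ∀ i j, v (x i j) ≤ γ

namespace EntriesLE

theorem mono {x : Matrix m n R} (hx : EntriesLE v γ x) (h : γ ≤ δ) : EntriesLE v δ x :=
  fun i j => (hx i j).trans h

theorem add {x y : Matrix m n R} (hx : EntriesLE v γ x) (hy : EntriesLE v γ y) :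
    EntriesLE v γ (x + y) :=
  fun i j => v.map_add_le (hx i j) (hy i j)

theorem sub {x y : Matrix m n R} (hx : EntriesLE v γ x) (hy : EntriesLE v γ y) :
    EntriesLE v γ (x - y) :=
  fun i j => v.map_sub_le (hx i j) (hy i j)

theorem mul [Fintype m] {x : Matrix l m R} {y : Matrix m n R} (hx : EntriesLE v γ x)
    (hy : EntriesLE v δ y) : EntriesLE v (γ * δ) (x * y) := by
  intro i j
  rw [Matrix.mul_apply]
  refine v.map_sum_le fun k _ => ?_
  rw [map_mul]
  exact mul_le_mul' (hx i k) (hy k j)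

theorem mul_of_le [Fintype m] {x : Matrix l m R} {y : Matrix m n R} (hx : EntriesLE v γ x)
    (hy : EntriesLE v δ y) (h : γ * δ ≤ ε) : EntriesLE v ε (x * y) :=
  (hx.mul hy).mono h

end EntriesLE

theorem entriesLE_zero : EntriesLE v γ (0 : Matrix m n R) := fun i j => by simp

theorem entriesLE_diagonal [DecidableEq n] {d : n → R} (hd : ∀ i, v (d i) ≤ γ) :
    EntriesLE v γ (Matrix.diagonal d) := by
  intro i j
  rw [Matrix.diagonal_apply]
  split_ifs <;> simp [hd]

theorem entriesLE_one [DecidableEq n] : EntriesLE v 1 (1 : Matrix n n R) :=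
  entriesLE_diagonal fun _ => (map_one v).le

theorem entriesLE_single [DecidableEq m] [DecidableEq n] {b : R} (hb : v b ≤ γ) (i : m) (j : n) :
    EntriesLE v γ (Matrix.single i j b) := by
  intro k l
  rw [Matrix.single_apply]
  split_ifs <;> simp [hb]

theorem entriesLE_of_fin_two {a b c d : R} (ha : v a ≤ γ) (hb : v b ≤ γ) (hc : v c ≤ γ)
    (hd : v d ≤ γ) : EntriesLE v γ !![a, b; c, d] := by
  intro i j
  fin_cases i <;> fin_cases j <;> simpa

end EntriesLE

section IntegralGL

variable {n R Γ : Type*} [Fintype n] [DecidableEq n] [Ring R] [LinearOrderedCommMonoidWithZero Γ]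
  {v : Valuation R Γ} {γ : Γ}

variable (n) in
/-- The group `GLₙ(𝒪_v)` of the invertible matrices that are integral together with their inverse,
`𝒪_v` being the valuation ring of `v`. -/
def integralGL (v : Valuation R Γ) : Subgroup (Matrix n n R)ˣ where
  carrier := {k | EntriesLE v 1 k.val ∧ EntriesLE v 1 k⁻¹.val}
  one_mem' := ⟨entriesLE_one, by simpa using entriesLE_one⟩
  mul_mem' hk hl := ⟨hk.1.mul_of_le hl.1 (mul_one 1).le, by
    rw [mul_inv_rev]
    exact hl.2.mul_of_le hk.2 (mul_one 1).le⟩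
  inv_mem' hk := ⟨hk.2, by simpa using hk.1⟩

theorem entriesLE_mul_left_iff {k : (Matrix n n R)ˣ} (hk : k ∈ integralGL n v) {x : Matrix n n R} :
    EntriesLE v γ (k.val * x) ↔ EntriesLE v γ x := by
  refine ⟨fun h => ?_, fun h => hk.1.mul_of_le h (one_mul γ).le⟩
  simpa using hk.2.mul_of_le h (one_mul γ).le

theorem entriesLE_mul_right_iff {k : (Matrix n n R)ˣ} (hk : k ∈ integralGL n v)
    {x : Matrix n n R} : EntriesLE v γ (x * k.val) ↔ EntriesLE v γ x := by
  refine ⟨fun h => ?_, fun h => h.mul_of_le hk.1 (mul_one γ).le⟩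
  simpa [mul_assoc] using h.mul_of_le hk.2 (mul_one γ).le

/-- The matrix `Matrix.swap R i j` as a unit. -/
def swapUnit (R : Type*) [Ring R] (i j : n) : (Matrix n n R)ˣ :=
  ⟨Matrix.swap R i j, Matrix.swap R i j, Matrix.swap_mul_self i j, Matrix.swap_mul_self i j⟩

theorem swapUnit_mem_integralGL (i j : n) : swapUnit R i j ∈ integralGL n v := by
  have h : EntriesLE v 1 (Matrix.swap R i j) := fun k l => by
    rw [Matrix.swap, Equiv.Perm.permMatrix, PEquiv.toMatrix_apply]
    split_ifs <;> simp
  exact ⟨h, h⟩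

variable (n R) in
/-- The invertible diagonal matrices. -/
def diagUnit : (n → Rˣ) →* (Matrix n n R)ˣ :=
  (Units.map (Matrix.diagonalRingHom n R : (n → R) →* Matrix n n R)).comp
    (MulEquiv.piUnits (M := fun _ : n => R)).symm.toMonoidHom

theorem val_diagUnit (a : n → Rˣ) :
    (diagUnit n R a).val = Matrix.diagonal fun i => (a i : R) := rfl

theorem val_inv_diagUnit (a : n → Rˣ) :
    (diagUnit n R a)⁻¹.val = Matrix.diagonal fun i => ((a i)⁻¹ : Rˣ).val := rfl

theorem diagUnit_mem_integralGL {a : n → Rˣ} (ha : ∀ i, v (a i) = 1) :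
    diagUnit n R a ∈ integralGL n v := by
  refine ⟨entriesLE_diagonal fun i => (ha i).le, entriesLE_diagonal fun i => ?_⟩
  change v ((a i)⁻¹ : Rˣ).val ≤ 1
  rw [← mul_one (v _), ← ha i, ← map_mul, Units.inv_mul, map_one, ha i]

/-- The matrix with columns `(1, 0)` and `(b, 1)`. -/
def upperUnit (b : R) : (Matrix (Fin 2) (Fin 2) R)ˣ where
  val := !![1, b; 0, 1]
  inv := !![1, -b; 0, 1]
  val_inv := by simp [Matrix.one_fin_two]
  inv_val := by simp [Matrix.one_fin_two]

/-- The matrix with columns `(1, b)` and `(0, 1)`. -/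
def lowerUnit (b : R) : (Matrix (Fin 2) (Fin 2) R)ˣ where
  val := !![1, 0; b, 1]
  inv := !![1, 0; -b, 1]
  val_inv := by simp [Matrix.one_fin_two]
  inv_val := by simp [Matrix.one_fin_two]

theorem upperUnit_mem_integralGL {b : R} (hb : v b ≤ 1) : upperUnit b ∈ integralGL (Fin 2) v :=
  ⟨entriesLE_of_fin_two (by simp) hb (by simp) (by simp),
    entriesLE_of_fin_two (by simp) (by rwa [v.map_neg]) (by simp) (by simp)⟩

theorem lowerUnit_mem_integralGL {b : R} (hb : v b ≤ 1) : lowerUnit b ∈ integralGL (Fin 2) v :=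
  ⟨entriesLE_of_fin_two (by simp) (by simp) hb (by simp),
    entriesLE_of_fin_two (by simp) (by simp) (by rwa [v.map_neg]) (by simp)⟩

end IntegralGL

section Cartan

variable {B Γ : Type*} [DivisionRing B] [LinearOrderedCommGroupWithZero Γ] {v : Valuation B Γ}
  {γ : Γ}

theorem entriesLE_mul_scalar_iff {n : Type*} [Fintype n] [DecidableEq n] {b : Bˣ}
    {x : Matrix n n B} :
    EntriesLE v γ (x * (diagUnit n B fun _ => b).val) ↔ EntriesLE v (γ * (v b)⁻¹) x := by
  refine forall₂_congr fun i j => ?_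
  rw [val_diagUnit, Matrix.mul_diagonal, map_mul, le_mul_inv_iff₀ (by simp [zero_lt_iff])]

theorem entriesLE_scalar_mul_iff {n : Type*} [Fintype n] [DecidableEq n] {b : Bˣ}
    {x : Matrix n n B} :
    EntriesLE v γ ((diagUnit n B fun _ => b).val * x) ↔ EntriesLE v (γ * (v b)⁻¹) x := by
  refine forall₂_congr fun i j => ?_
  rw [val_diagUnit, Matrix.diagonal_mul, map_mul, le_mul_inv_iff₀ (by simp [zero_lt_iff]), mul_comm]

theorem eq_upperUnit_mul_diagonal_mul_lowerUnit {a b c d : B} (hd : d ≠ 0) :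
    !![a, b; c, d] = (upperUnit (b * d⁻¹)).val * Matrix.diagonal ![a - b * d⁻¹ * c, d] *
      (lowerUnit (d⁻¹ * c)).val := by
  simp [upperUnit, lowerUnit, Matrix.diagonal_fin_two, hd, mul_assoc]

theorem ne_zero_of_val_eq_diagonal {n R : Type*} [Fintype n] [DecidableEq n] [Ring R] [Nontrivial R]
    {x : (Matrix n n R)ˣ} {a : n → R} (hx : x.val = Matrix.diagonal a) (i : n) : a i ≠ 0 := by
  intro ha
  have h := congrFun (congrFun x.mul_inv i) i
  rw [hx, Matrix.diagonal_mul, ha, zero_mul, Matrix.one_apply_eq] at h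
  exact zero_ne_one h

theorem exists_eq_mul_diagUnit_mul_of_entriesLE {x : (Matrix (Fin 2) (Fin 2) B)ˣ}
    (h : EntriesLE v (v (x.val 1 1)) x.val) :
    ∃ k ∈ integralGL (Fin 2) v, ∃ l ∈ integralGL (Fin 2) v, ∃ a : Fin 2 → Bˣ,
      v (a 0) ≤ v (a 1) ∧ x = k * diagUnit (Fin 2) B a * l := by
  have hd : x.val 1 1 ≠ 0 := fun hd => x.ne_zero <| by
    ext i j
    simpa [hd] using h i j
  have hcol : v (x.val 0 1 * (x.val 1 1)⁻¹) ≤ 1 := by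
    rw [map_mul, map_inv₀]
    exact mul_inv_le_one_of_le₀ (h 0 1) zero_le
  have hrow : v ((x.val 1 1)⁻¹ * x.val 1 0) ≤ 1 := by
    rw [map_mul, map_inv₀]
    exact inv_mul_le_one_of_le₀ (h 1 0) zero_le
  set k := upperUnit (x.val 0 1 * (x.val 1 1)⁻¹)
  set l := lowerUnit ((x.val 1 1)⁻¹ * x.val 1 0)
  set e := x.val 0 0 - x.val 0 1 * (x.val 1 1)⁻¹ * x.val 1 0
  have hx : x.val = k.val * Matrix.diagonal ![e, x.val 1 1] * l.val :=
    (Matrix.eta_fin_two x.val).trans (eq_upperUnit_mul_diagonal_mul_lowerUnit hd)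
  have hdiag : (k⁻¹ * x * l⁻¹).val = Matrix.diagonal ![e, x.val 1 1] := by
    rw [Units.val_mul, Units.val_mul, Units.mul_inv_eq_iff_eq_mul, Units.inv_mul_eq_iff_eq_mul,
      ← mul_assoc]
    exact hx
  refine ⟨k, upperUnit_mem_integralGL hcol, l, lowerUnit_mem_integralGL hrow,
    fun i => Units.mk0 _ (ne_zero_of_val_eq_diagonal hdiag i),
    v.map_sub_le (h 0 0) ?_, Units.ext hx⟩
  rw [map_mul]
  exact mul_le_of_le_one_of_le hcol (h 1 0)

theorem exists_eq_mul_diagUnit_mul (v : Valuation B Γ) (x : (Matrix (Fin 2) (Fin 2) B)ˣ) :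
    ∃ k ∈ integralGL (Fin 2) v, ∃ l ∈ integralGL (Fin 2) v, ∃ a : Fin 2 → Bˣ,
      v (a 0) ≤ v (a 1) ∧ x = k * diagUnit (Fin 2) B a * l := by
  obtain ⟨⟨i, j⟩, hij⟩ := Finite.exists_max fun p : Fin 2 × Fin 2 => v (x.val p.1 p.2)
  set p := swapUnit B 1 i
  set q := swapUnit B 1 j
  have hp : p ∈ integralGL (Fin 2) v := swapUnit_mem_integralGL 1 i
  have hq : q ∈ integralGL (Fin 2) v := swapUnit_mem_integralGL 1 j
  have hentry : (p * x * q).val 1 1 = x.val i j := by simp [p, q, swapUnit]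
  have hmax : EntriesLE v (v ((p * x * q).val 1 1)) (p * x * q).val := by
    rw [hentry, Units.val_mul, Units.val_mul, entriesLE_mul_right_iff hq, entriesLE_mul_left_iff hp]
    exact fun c d => hij (c, d)
  obtain ⟨k, hk, l, hl, a, ha, h⟩ := exists_eq_mul_diagUnit_mul_of_entriesLE hmax
  refine ⟨p⁻¹ * k, mul_mem (inv_mem hp) hk, l * q⁻¹, mul_mem hl (inv_mem hq), a, ha, ?_⟩
  calc x = p⁻¹ * (p * x * q) * q⁻¹ := by group
    _ = p⁻¹ * k * diagUnit (Fin 2) B a * (l * q⁻¹) := by rw [h]; group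

end Cartan

section Lattices

theorem span_eq_top_of_exists_smul {R K M : Type*} [CommRing R] [Field K] [Algebra R K]
    [FaithfulSMul R K] [AddCommGroup M] [Module R M] [Module K M] [IsScalarTower R K M]
    {S : Submodule R M} (h : ∀ x : M, ∃ c : R, c ≠ 0 ∧ c • x ∈ S) :
    Submodule.span K (S : Set M) = ⊤ := by
  refine eq_top_iff.mpr fun x _ => ?_
  obtain ⟨c, hc, hx⟩ := h x
  have hc' : algebraMap R K c ≠ 0 := by
    rwa [Ne, FaithfulSMul.algebraMap_eq_zero_iff]
  rw [← inv_smul_smul₀ hc' x, algebraMap_smul]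
  exact Submodule.smul_mem _ _ (Submodule.subset_span hx)

theorem sum_single_mul_mul_single {n R : Type*} [Fintype n] [DecidableEq n] [Semiring R]
    (x : Matrix n n R) (i j : n) :
    ∑ k, Matrix.single k i 1 * x * Matrix.single j k 1 = Matrix.scalar n (x i j) := by
  simp [Matrix.scalar_apply, Matrix.sum_single_eq_diagonal]

theorem IsLattice.map₂_mulVecBilin {K : Type*} [Field K] [ValuativeRel K] {B : Type*}
    [DivisionRing B] [Algebra K B] {L : Submodule 𝒪[K] (Fin 2 → B)} (hL : IsLattice L)
    {D : Subalgebra 𝒪[K] (Matrix (Fin 2) (Fin 2) B)} (hD : IsOrder D) :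
    IsLattice (Submodule.map₂ (Matrix.mulVecBilin 𝒪[K] 𝒪[K]) (Subalgebra.toSubmodule D) L) where
  fg := hD.map₂ _ hL.fg
  span_eq_top := by
    rw [eq_top_iff, ← hL.span_eq_top]
    refine Submodule.span_mono fun w hw => ?_
    rw [← Matrix.one_mulVec w]
    exact Submodule.apply_mem_map₂ _ (show 1 ∈ Subalgebra.toSubmodule D from one_mem D) hw
  mul_mem := by
    intro w hw b hb
    set L' := Submodule.map₂ (Matrix.mulVecBilin 𝒪[K] 𝒪[K]) (Subalgebra.toSubmodule D) L
    suffices hle : L' ≤ L'.comap (DistribSMul.toLinearMap 𝒪[K] (Fin 2 → B) (MulOpposite.op b)) from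
      hle hw
    refine Submodule.map₂_le.mpr fun A hA w hw => ?_
    rw [Submodule.mem_comap, DistribSMul.toLinearMap_apply, Matrix.mulVecBilin_apply,
      ← Matrix.mulVec_smul]
    exact Submodule.apply_mem_map₂ _ hA (hL.mul_mem w hw b hb)

theorem mulVec_mem_map₂_mulVecBilin {R B n : Type*} [CommRing R] [Ring B] [Algebra R B] [Fintype n]
    [DecidableEq n] {D : Subalgebra R (Matrix n n B)} {L : Submodule R (n → B)} {A : Matrix n n B}
    (hA : A ∈ D) {w : n → B}
    (hw : w ∈ Submodule.map₂ (Matrix.mulVecBilin R R) (Subalgebra.toSubmodule D) L) :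
    A.mulVec w ∈ Submodule.map₂ (Matrix.mulVecBilin R R) (Subalgebra.toSubmodule D) L := by
  set L' := Submodule.map₂ (Matrix.mulVecBilin R R) (Subalgebra.toSubmodule D) L
  suffices hle : L' ≤ L'.comap (Matrix.mulVecBilin R R A) from hle hw
  refine Submodule.map₂_le.mpr fun A' hA' w hw => ?_
  rw [Submodule.mem_comap, Matrix.mulVecBilin_apply, Matrix.mulVecBilin_apply, Matrix.mulVec_mulVec]
  exact Submodule.apply_mem_map₂ _ (D.mul_mem hA hA') hw

variable {K : Type*} [Field K] [ValuativeRel K] {B : Type*} [DivisionRing B] [Algebra K B]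
  {Γ : Type*} [LinearOrderedCommGroupWithZero Γ] {v : Valuation B Γ} {π : B}

namespace IsIntegerValuation

theorem val_pos (hv : IsIntegerValuation K v π) : 0 < v π :=
  zero_lt_iff.mpr (v.ne_zero_iff.mpr hv.ne_zero)

theorem map_smul_le (hv : IsIntegerValuation K v π) (c : 𝒪[K]) (b : B) : v (c • b) ≤ v b := by
  rw [Algebra.smul_def, map_mul]
  exact mul_le_of_le_one_left' ((hv.mem_integers _).mp isIntegral_algebraMap)

theorem exists_pow (hv : IsIntegerValuation K v π) {b : B} (hb : b ≠ 0) (h : v b ≤ 1) :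
    ∃ s : ℕ, v b = v π ^ s := by
  obtain ⟨k, hk⟩ := hv.exists_zpow b hb
  rw [hk, zpow_le_one_iff_right_of_lt_one₀ hv.val_pos hv.lt_one] at h
  lift k to ℕ using h
  exact ⟨k, by rw [hk, zpow_natCast]⟩

theorem le_of_lt_one (hv : IsIntegerValuation K v π) {b : B} (h : v b < 1) : v b ≤ v π := by
  by_cases hb : b = 0
  · simp [hb]
  obtain ⟨s, hs⟩ := hv.exists_pow hb h.le
  rw [hs]
  refine pow_le_of_le_one zero_le hv.lt_one.le ?_
  rintro rfl
  simp [hs] at h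

theorem mem_maxIdeal_iff (hv : IsIntegerValuation K v π) {b : B} :
    b ∈ maxIdeal K B ↔ v b < 1 := by
  simp only [maxIdeal, Set.mem_ofPred_eq, hv.mem_integers]
  refine ⟨fun ⟨h, h'⟩ => lt_of_le_of_ne h fun h1 => h' ⟨b⁻¹, ?_, ?_⟩, fun h => ⟨h.le, ?_⟩⟩
  · rw [map_inv₀, h1, inv_one]
  · exact mul_inv_cancel₀ (by rintro rfl; simp at h1)
  · rintro ⟨c, hc, hbc⟩
    have := congrArg v hbc
    rw [map_mul, map_one] at this
    exact absurd this (mul_lt_one_of_lt_of_le h hc).ne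

theorem exists_smul_forall (hv : IsIntegerValuation K v π) {ι : Type*} [Finite ι] (f : ι → B) :
    ∃ c : 𝒪[K], c ≠ 0 ∧ ∀ i, v (c • f i) ≤ 1 := by
  classical
  have := Fintype.ofFinite ι
  choose c hc hc' using fun i => hv.exists_smul (f i)
  refine ⟨∏ i, c i, Finset.prod_ne_zero_iff.mpr fun i _ => hc i, fun i => ?_⟩
  rw [← Finset.prod_erase_mul _ _ (Finset.mem_univ i), mul_smul]
  exact (hv.map_smul_le _ _).trans (hc' i)

theorem exists_forall_le_of_fg (hv : IsIntegerValuation K v π) {M : Submodule 𝒪[K] B}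
    (hM : M.FG) : ∃ b ∈ M, ∀ c ∈ M, v c ≤ v b := by
  induction M, hM using Submodule.fg_induction with
  | singleton x =>
    refine ⟨x, Submodule.mem_span_singleton_self x, fun c hc => ?_⟩
    obtain ⟨r, rfl⟩ := Submodule.mem_span_singleton.mp hc
    exact hv.map_smul_le r x
  | sup M N _ _ hM hN =>
    obtain ⟨a, ha, hMa⟩ := hM
    obtain ⟨b, hb, hNb⟩ := hN
    have hle : ∀ c ∈ M ⊔ N, v c ≤ max (v a) (v b) := fun c hc => by
      obtain ⟨x, hx, y, hy, rfl⟩ := Submodule.mem_sup.mp hc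
      exact v.map_add_le (le_max_of_le_left (hMa x hx)) (le_max_of_le_right (hNb y hy))
    rcases le_total (v a) (v b) with h | h
    · exact ⟨b, Submodule.mem_sup_right hb, fun c hc => (hle c hc).trans (max_le h le_rfl)⟩
    · exact ⟨a, Submodule.mem_sup_left ha, fun c hc => (hle c hc).trans (max_le le_rfl h)⟩

/-- The valuation ring `𝒪_B` of `v`, as a module over `𝒪[K]`. -/
def integerModule (hv : IsIntegerValuation K v π) : Submodule 𝒪[K] B where
  carrier := {b | v b ≤ 1}
  add_mem' ha hb := v.map_add_le ha hb
  zero_mem' := by simp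
  smul_mem' c b hb := (hv.map_smul_le c b).trans hb

theorem integerModule_fg [IsNoetherianRing 𝒪[K]] (hv : IsIntegerValuation K v π) :
    hv.integerModule.FG := by
  obtain ⟨M, hM, hle⟩ := hv.exists_fg
  have : IsNoetherian 𝒪[K] M := isNoetherian_of_fg_of_noetherian M hM
  exact hM.of_le hle

variable {n : Type*} [Fintype n] [DecidableEq n]

/-- The lattice `g 𝒪_B ^ n`. -/
noncomputable def lat (hv : IsIntegerValuation K v π) (g : (Matrix n n B)ˣ) :
    Submodule 𝒪[K] (n → B) :=
  (Submodule.pi Set.univ fun _ => hv.integerModule).comap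
    (Matrix.mulVecBilin 𝒪[K] 𝒪[K] g⁻¹.val)

theorem mem_lat {hv : IsIntegerValuation K v π} {g : (Matrix n n B)ˣ} {w : n → B} :
    w ∈ hv.lat g ↔ ∀ i, v ((g⁻¹.val.mulVec w) i) ≤ 1 :=
  ⟨fun h i => h i trivial, fun h i _ => h i⟩

/-- The algebra `M_n(𝒪_B)` of the integral matrices. -/
def integralMatrices (n : Type*) [Fintype n] [DecidableEq n] (hv : IsIntegerValuation K v π) :
    Subalgebra 𝒪[K] (Matrix n n B) where
  carrier := {x | EntriesLE v 1 x}
  add_mem' := EntriesLE.add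
  mul_mem' hx hy := hx.mul_of_le hy (one_mul 1).le
  algebraMap_mem' _ := entriesLE_diagonal fun _ => (hv.mem_integers _).mp isIntegral_algebraMap

/-- The order `g M_n(𝒪_B) g⁻¹`, the endomorphism ring of the lattice `g 𝒪_B ^ n`. -/
noncomputable def ord (hv : IsIntegerValuation K v π) (g : (Matrix n n B)ˣ) :
    Subalgebra 𝒪[K] (Matrix n n B) :=
  (hv.integralMatrices n).comap
    (MulSemiringAction.toAlgEquiv 𝒪[K] (Matrix n n B) (ConjAct.toConjAct g⁻¹))

theorem mem_ord {hv : IsIntegerValuation K v π} {g : (Matrix n n B)ˣ} {x : Matrix n n B} :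
    x ∈ hv.ord g ↔ EntriesLE v 1 (g⁻¹.val * x * g.val) := Iff.rfl

theorem col_mem_lat (hv : IsIntegerValuation K v π) (g : (Matrix n n B)ˣ) (j : n) :
    g.val.col j ∈ hv.lat g := by
  rw [mem_lat, ← Matrix.mulVec_single_one, Matrix.mulVec_mulVec, Units.inv_mul]
  intro i
  simpa using entriesLE_one i j

theorem forall_mem_lat_mulVec_iff {hv : IsIntegerValuation K v π} {g : (Matrix n n B)ˣ}
    {x : Matrix n n B} :
    (∀ w ∈ hv.lat g, ∀ i, v ((x.mulVec w) i) ≤ 1) ↔ EntriesLE v 1 (x * g.val) := by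
  refine ⟨fun h i j => h _ (hv.col_mem_lat g j) i, fun h w hw i => ?_⟩
  have hxw : x.mulVec w = (x * g.val).mulVec (g⁻¹.val.mulVec w) := by simp [mul_assoc]
  rw [hxw, Matrix.mulVec, dotProduct]
  refine v.map_sum_le fun j _ => ?_
  rw [map_mul]
  exact mul_le_one' (h i j) (mem_lat.mp hw j)

theorem lat_le_lat_iff {hv : IsIntegerValuation K v π} {g h : (Matrix n n B)ˣ} :
    hv.lat g ≤ hv.lat h ↔ EntriesLE v 1 (h⁻¹.val * g.val) := by
  rw [← forall_mem_lat_mulVec_iff (hv := hv)]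
  exact forall₂_congr fun w _ => mem_lat

theorem mem_ord_iff_forall_mulVec_mem {hv : IsIntegerValuation K v π} {g : (Matrix n n B)ˣ}
    {x : Matrix n n B} : x ∈ hv.ord g ↔ ∀ w ∈ hv.lat g, x.mulVec w ∈ hv.lat g := by
  simp only [mem_ord, mem_lat (w := x.mulVec _), Matrix.mulVec_mulVec, forall_mem_lat_mulVec_iff]

theorem isEndOf_lat_iff {hv : IsIntegerValuation K v π} {g : (Matrix (Fin 2) (Fin 2) B)ˣ}
    {D : Subalgebra 𝒪[K] (Matrix (Fin 2) (Fin 2) B)} :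
    IsEndOf D (hv.lat g) ↔ D = hv.ord g := by
  simp only [IsEndOf, ← mem_ord_iff_forall_mulVec_mem, SetLike.ext_iff]

theorem op_smul_mem_lat (hv : IsIntegerValuation K v π) {g : (Matrix n n B)ˣ} {w : n → B}
    (hw : w ∈ hv.lat g) {b : B} (hb : v b ≤ 1) : MulOpposite.op b • w ∈ hv.lat g := by
  rw [mem_lat, Matrix.mulVec_smul]
  intro i
  rw [Pi.smul_apply, MulOpposite.smul_eq_mul_unop, map_mul]
  exact mul_le_one' (mem_lat.mp hw i) hb

theorem lat_fg [IsNoetherianRing 𝒪[K]] (hv : IsIntegerValuation K v π) (g : (Matrix n n B)ˣ) :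
    (hv.lat g).FG := by
  have h : hv.lat g = (Submodule.pi Set.univ fun _ => hv.integerModule).map
      (Matrix.mulVecBilin 𝒪[K] 𝒪[K] g.val) := by
    refine le_antisymm (fun w hw => ⟨g⁻¹.val.mulVec w, hw, ?_⟩)
      (Submodule.map_le_iff_le_comap.mpr ?_)
    · intro w hw
      rwa [Submodule.mem_comap, lat, Submodule.mem_comap, Matrix.mulVecBilin_apply,
        Matrix.mulVecBilin_apply, Matrix.mulVec_mulVec, Units.inv_mul, Matrix.one_mulVec]
    · rw [Matrix.mulVecBilin_apply, Matrix.mulVec_mulVec, Units.mul_inv, Matrix.one_mulVec]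
  rw [h]
  exact (Submodule.fg_pi fun _ => hv.integerModule_fg).map _

theorem ord_fg [IsNoetherianRing 𝒪[K]] (hv : IsIntegerValuation K v π) (g : (Matrix n n B)ˣ) :
    (Subalgebra.toSubmodule (hv.ord g)).FG := by
  let e : (n → n → B) ≃ₗ[𝒪[K]] Matrix n n B := (Matrix.ofLinearEquiv 𝒪[K]).trans
    (MulSemiringAction.toAlgEquiv 𝒪[K] (Matrix n n B) (ConjAct.toConjAct g)).toLinearEquiv
  have h : Subalgebra.toSubmodule (hv.ord g) =
      (Submodule.pi Set.univ fun _ => Submodule.pi Set.univ fun _ => hv.integerModule).map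
        e.toLinearMap := by
    rw [Submodule.map_equiv_eq_comap_symm]
    ext x
    exact ⟨fun hx i _ j _ => hx i j, fun hx i j => hx i trivial j trivial⟩
  rw [h]
  exact (Submodule.fg_pi fun _ => Submodule.fg_pi fun _ => hv.integerModule_fg).map _

theorem span_lat_eq_top (hv : IsIntegerValuation K v π) (g : (Matrix n n B)ˣ) :
    Submodule.span K (hv.lat g : Set (n → B)) = ⊤ := by
  refine span_eq_top_of_exists_smul fun w => ?_
  obtain ⟨c, hc, h⟩ := hv.exists_smul_forall (g⁻¹.val.mulVec w)
  refine ⟨c, hc, mem_lat.mpr ?_⟩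
  rwa [Matrix.mulVec_smul]

theorem span_ord_eq_top (hv : IsIntegerValuation K v π) (g : (Matrix n n B)ˣ) :
    Submodule.span K (hv.ord g : Set (Matrix n n B)) = ⊤ := by
  refine span_eq_top_of_exists_smul (S := Subalgebra.toSubmodule (hv.ord g)) fun x => ?_
  obtain ⟨c, hc, h⟩ := hv.exists_smul_forall fun p : n × n => (g⁻¹.val * x * g.val) p.1 p.2
  refine ⟨c, hc, ?_⟩
  rw [Subalgebra.mem_toSubmodule, mem_ord, mul_smul_comm, smul_mul_assoc]
  exact fun i j => h (i, j)

theorem entriesLE_one_of_mem (hv : IsIntegerValuation K v π) {H : Subalgebra 𝒪[K] (Matrix n n B)}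
    (hH : (Subalgebra.toSubmodule H).FG) (hsingle : ∀ i j, Matrix.single i j 1 ∈ H)
    {x : Matrix n n B} (hx : x ∈ H) : EntriesLE v 1 x := by
  intro i j
  have : Nonempty n := ⟨i⟩
  have hscalar : Matrix.scalarAlgHom n 𝒪[K] (x i j) ∈ H := by
    rw [Matrix.scalarAlgHom_apply, ← sum_single_mul_mul_single]
    exact sum_mem fun k _ => mul_mem (mul_mem (hsingle k i) hx) (hsingle j k)
  rw [← hv.mem_integers]
  exact (isIntegral_algHom_iff (Matrix.scalarAlgHom n 𝒪[K])
    fun _ _ => Matrix.scalar_inj.mp).mp (IsIntegral.of_mem_of_fg H hH _ hscalar)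

theorem isLattice_lat [IsNoetherianRing 𝒪[K]] (hv : IsIntegerValuation K v π)
    (g : (Matrix (Fin 2) (Fin 2) B)ˣ) : IsLattice (hv.lat g) where
  fg := hv.lat_fg g
  span_eq_top := hv.span_lat_eq_top g
  mul_mem _ hw b hb := hv.op_smul_mem_lat hw ((hv.mem_integers b).mp hb)

theorem isFullOrder_ord [IsNoetherianRing 𝒪[K]] (hv : IsIntegerValuation K v π)
    (g : (Matrix (Fin 2) (Fin 2) B)ˣ) : IsFullOrder (hv.ord g) :=
  ⟨hv.ord_fg g, hv.span_ord_eq_top g⟩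

theorem isMaximalOrder_ord [IsNoetherianRing 𝒪[K]] (hv : IsIntegerValuation K v π)
    (g : (Matrix (Fin 2) (Fin 2) B)ˣ) : IsMaximalOrder (hv.ord g) := by
  refine ⟨hv.isFullOrder_ord g, fun H hH hle x hx => ?_⟩
  let e := MulSemiringAction.toAlgEquiv 𝒪[K] (Matrix (Fin 2) (Fin 2) B) (ConjAct.toConjAct g⁻¹)
  refine hv.entriesLE_one_of_mem (H := H.map e.toAlgHom) ?_ (fun i j => ?_) ⟨x, hx, rfl⟩
  · rw [Subalgebra.map_toSubmodule]
    exact hH.1.map _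
  · refine ⟨e.symm (Matrix.single i j 1), hle ?_, e.apply_symm_apply _⟩
    change EntriesLE v 1 (e (e.symm (Matrix.single i j 1)))
    rw [e.apply_symm_apply]
    exact entriesLE_single (map_one v).le i j

theorem lat_le (hv : IsIntegerValuation K v π) {L : Submodule 𝒪[K] (n → B)}
    (hL : ∀ w ∈ L, ∀ b ∈ integers K B, MulOpposite.op b • w ∈ L) {g : (Matrix n n B)ˣ}
    (hg : ∀ j, g.val.col j ∈ L) : hv.lat g ≤ L := by
  intro w hw
  have hsum : w = ∑ j, MulOpposite.op ((g⁻¹.val.mulVec w) j) • g.val.col j :=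
    calc w = g.val.mulVec (g⁻¹.val.mulVec w) := by simp
      _ = _ := Matrix.mulVec_eq_sum _ _
  rw [hsum]
  exact sum_mem fun j _ => hL _ (hg j) _ ((hv.mem_integers _).mpr (mem_lat.mp hw j))

theorem exists_triangular_generators [IsNoetherianRing 𝒪[K]] (hv : IsIntegerValuation K v π)
    {L : Submodule 𝒪[K] (Fin 2 → B)} (hL : IsLattice L) :
    (∃ u ∈ L, u 0 ≠ 0 ∧ ∀ w ∈ L, v (w 0) ≤ v (u 0)) ∧
      ∃ b ≠ 0, ![0, b] ∈ L ∧ ∀ c, ![0, c] ∈ L → v c ≤ v b := by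
  let p : Fin 2 → (Fin 2 → B) →ₗ[𝒪[K]] B := fun i => LinearMap.proj i
  let M : Submodule 𝒪[K] B := L.comap (LinearMap.single 𝒪[K] (fun _ => B) 1)
  have hfg : ∀ i, (L.map (p i)).FG := fun i => hL.fg.map _
  have hM : M.FG := by
    have : IsNoetherian 𝒪[K] (L.map (p 1)) := isNoetherian_of_fg_of_noetherian _ (hfg 1)
    exact (hfg 1).of_le fun b hb => ⟨_, hb, by simp [p]⟩
  have hmem : ∀ c, c ∈ M ↔ ![0, c] ∈ L := fun c => by
    have hc : ![0, c] = Pi.single 1 c := by ext i; fin_cases i <;> simp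
    rw [hc]
    rfl
  have hsmul : ∀ w : Fin 2 → B, ∃ c : 𝒪[K], c ≠ 0 ∧ c • w ∈ L := fun w => by
    obtain ⟨c, hc⟩ := multiple_mem_span_of_mem_localization_span (nonZeroDivisors 𝒪[K]) K
      (L : Set (Fin 2 → B)) w (hL.span_eq_top ▸ Submodule.mem_top)
    rw [Submodule.span_eq] at hc
    exact ⟨c, nonZeroDivisors.coe_ne_zero c, hc⟩
  have hne : ∀ {b : B} {c : 𝒪[K]}, c ≠ 0 → v (c • 1) ≤ v b → b ≠ 0 := by
    rintro _ c hc hle rfl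
    rw [map_zero, le_zero_iff, map_eq_zero] at hle
    exact smul_ne_zero hc one_ne_zero hle
  obtain ⟨_, ⟨u, hu, rfl⟩, humax⟩ := hv.exists_forall_le_of_fg (hfg 0)
  obtain ⟨b, hb, hbmax⟩ := hv.exists_forall_le_of_fg hM
  obtain ⟨c, hc, hcL⟩ := hsmul 1
  obtain ⟨d, hd, hdL⟩ := hsmul (Pi.single 1 1)
  have hdM : d • 1 ∈ M := by rwa [Submodule.mem_comap, map_smul]
  exact ⟨⟨u, hu, hne hc (humax _ ⟨_, hcL, rfl⟩), fun w hw => humax _ ⟨w, hw, rfl⟩⟩,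
    b, hne hd (hbmax _ hdM), (hmem b).mp hb, fun c hc => hbmax c ((hmem c).mpr hc)⟩

theorem exists_eq_lat [IsNoetherianRing 𝒪[K]] (hv : IsIntegerValuation K v π)
    {L : Submodule 𝒪[K] (Fin 2 → B)} (hL : IsLattice L) :
    ∃ g : (Matrix (Fin 2) (Fin 2) B)ˣ, L = hv.lat g := by
  obtain ⟨⟨u, hu, hu0, humax⟩, b, hb0, hb, hbmax⟩ := hv.exists_triangular_generators hL
  let g : (Matrix (Fin 2) (Fin 2) B)ˣ := lowerUnit (u 1 * (u 0)⁻¹) *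
    diagUnit (Fin 2) B ![Units.mk0 (u 0) hu0, Units.mk0 b hb0]
  have hcol : g.val = !![u 0, 0; u 1, b] := by
    simp [g, lowerUnit, val_diagUnit, Matrix.diagonal_fin_two, hu0]
  refine ⟨g, le_antisymm (fun w hw => mem_lat.mpr ?_) (hv.lat_le hL.mul_mem fun j => ?_)⟩
  · set c := (u 0)⁻¹ * w 0
    have hcoord : g⁻¹.val.mulVec w = ![c, b⁻¹ * (w 1 - u 1 * c)] := by
      have hw' : w = g.val.mulVec ![c, b⁻¹ * (w 1 - u 1 * c)] := by
        rw [hcol]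
        ext i
        fin_cases i <;> simp [c, hu0, hb0]
      conv_lhs => rw [hw']
      rw [Matrix.mulVec_mulVec, Units.inv_mul, Matrix.one_mulVec]
    have hc : v c ≤ 1 := by
      rw [map_mul, map_inv₀]
      exact inv_mul_le_one_of_le₀ (humax w hw) zero_le
    have hsub : ![0, w 1 - u 1 * c] = w - MulOpposite.op c • u := by
      ext i
      fin_cases i <;> simp [c, hu0]
    have hmem : ![0, w 1 - u 1 * c] ∈ L := by
      rw [hsub]
      exact sub_mem hw (hL.mul_mem u hu c ((hv.mem_integers c).mpr hc))
    rw [hcoord, Fin.forall_fin_two]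
    refine ⟨hc, ?_⟩
    change v (b⁻¹ * (w 1 - u 1 * c)) ≤ 1
    rw [map_mul, map_inv₀]
    exact inv_mul_le_one_of_le₀ (hbmax _ hmem) zero_le
  · fin_cases j
    · convert hu
      rw [hcol]
      ext i; fin_cases i <;> simp
    · convert hb
      rw [hcol]
      ext i; fin_cases i <;> simp

theorem exists_eq_ord [IsNoetherianRing 𝒪[K]] (hv : IsIntegerValuation K v π)
    {D : Subalgebra 𝒪[K] (Matrix (Fin 2) (Fin 2) B)} (hD : IsMaximalOrder D) :
    ∃ g : (Matrix (Fin 2) (Fin 2) B)ˣ, D = hv.ord g := by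
  obtain ⟨g, hg⟩ := hv.exists_eq_lat ((hv.isLattice_lat 1).map₂_mulVecBilin hD.1.1)
  refine ⟨g, hD.eq_of_le (hv.isFullOrder_ord g) fun A hA => ?_⟩
  rw [mem_ord_iff_forall_mulVec_mem, ← hg]
  exact fun w hw => mulVec_mem_map₂_mulVecBilin hA hw

end IsIntegerValuation

end Lattices

section Tree

section IsNear

variable {n R Γ : Type*} [Fintype n] [DecidableEq n] [Ring R] [LinearOrderedCommMonoidWithZero Γ]
  {v : Valuation R Γ} {γ γ' : Γ} {g h i : (Matrix n n R)ˣ}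

/-- The elementary divisors of `g⁻¹ * h` differ by a factor of valuation at least `γ`. For matrices
of size two and `γ = v π ^ t`, with `π` a uniformizer, the vertices of the tree attached to `g` and
`h` are then at distance at most `t`. -/
def IsNear (v : Valuation R Γ) (γ : Γ) (g h : (Matrix n n R)ˣ) : Prop :=
  ∃ δ ε, EntriesLE v δ (g⁻¹.val * h.val) ∧ EntriesLE v ε (h⁻¹.val * g.val) ∧ γ * (δ * ε) ≤ 1

namespace IsNear

theorem symm (H : IsNear v γ g h) : IsNear v γ h g := by
  obtain ⟨δ, ε, hδ, hε, hle⟩ := H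
  exact ⟨ε, δ, hε, hδ, by rwa [mul_comm ε]⟩

theorem trans (H : IsNear v γ g h) (H' : IsNear v γ' h i) : IsNear v (γ * γ') g i := by
  obtain ⟨δ, ε, hδ, hε, hle⟩ := H
  obtain ⟨δ', ε', hδ', hε', hle'⟩ := H'
  refine ⟨δ * δ', ε' * ε, ?_, ?_, ?_⟩
  · simpa [mul_assoc] using hδ.mul hδ'
  · simpa [mul_assoc] using hε'.mul hε
  · rw [mul_comm ε', mul_mul_mul_comm δ, mul_mul_mul_comm]
    exact mul_le_one' hle hle'

theorem mono (H : IsNear v γ g h) (hγ : γ' ≤ γ) : IsNear v γ' g h := by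
  obtain ⟨δ, ε, hδ, hε, hle⟩ := H
  exact ⟨δ, ε, hδ, hε, (mul_le_mul_left hγ _).trans hle⟩

end IsNear

end IsNear

theorem mul_single_mul_apply {n R : Type*} [Fintype n] [DecidableEq n] [Semiring R]
    (x y : Matrix n n R) (a : R) (i j k l : n) :
    (x * Matrix.single i j a * y) k l = x k i * a * y j l := by
  rw [Matrix.mul_apply, Finset.sum_eq_single j _ (by simp), Matrix.mul_single_apply_same]
  intro b _ hb
  simp [hb]

theorem inv_val_mul_mul_val_mul {M : Type*} [Monoid M] (g k : Mˣ) (x : M) :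
    (g * k)⁻¹.val * x * (g * k).val = k⁻¹.val * (g⁻¹.val * x * g.val) * k.val := by
  simp only [mul_inv_rev, Units.val_mul, mul_assoc]

variable {K : Type*} [Field K] [ValuativeRel K] {B : Type*} [DivisionRing B] [Algebra K B]
  {Γ : Type*} [LinearOrderedCommGroupWithZero Γ] {v : Valuation B Γ} {π : B}

namespace IsIntegerValuation

section Ord

variable {n : Type*} [Fintype n] [DecidableEq n] {g h : (Matrix n n B)ˣ}

theorem ord_mul_of_mem_integralGL (hv : IsIntegerValuation K v π) (g : (Matrix n n B)ˣ)
    {k : (Matrix n n B)ˣ} (hk : k ∈ integralGL n v) : hv.ord (g * k) = hv.ord g := by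
  ext x
  rw [mem_ord, mem_ord, inv_val_mul_mul_val_mul, entriesLE_mul_right_iff hk,
    entriesLE_mul_left_iff (inv_mem hk)]

theorem ord_mul_scalar (hv : IsIntegerValuation K v π) (g : (Matrix n n B)ˣ) (b : Bˣ) :
    hv.ord (g * diagUnit n B fun _ => b) = hv.ord g := by
  ext x
  have hinv : (diagUnit n B fun _ => b)⁻¹ = diagUnit n B fun _ => b⁻¹ := (map_inv _ _).symm
  rw [mem_ord, mem_ord, inv_val_mul_mul_val_mul, entriesLE_mul_scalar_iff, hinv,
    entriesLE_scalar_mul_iff, Units.val_inv_eq_inv_val, map_inv₀, inv_inv, one_mul,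
    inv_mul_cancel₀ (by simp)]

theorem isNear_of_forall_mem_ord [Nonempty n] (hv : IsIntegerValuation K v π) {a : B}
    (H : ∀ x, EntriesLE v (v a) (g⁻¹.val * x * g.val) → x ∈ hv.ord h) : IsNear v (v a) g h := by
  obtain ⟨⟨j, l⟩, hδ⟩ := Finite.exists_max fun p : n × n => v ((g⁻¹.val * h.val) p.1 p.2)
  obtain ⟨⟨k, i⟩, hε⟩ := Finite.exists_max fun p : n × n => v ((h⁻¹.val * g.val) p.1 p.2)
  refine ⟨_, _, fun _ _ => hδ (_, _), fun _ _ => hε (_, _), ?_⟩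
  have hmem : g.val * Matrix.single i j a * g⁻¹.val ∈ hv.ord h := by
    refine H _ ?_
    simpa [mul_assoc] using entriesLE_single le_rfl i j
  have hentry : (h⁻¹.val * (g.val * Matrix.single i j a * g⁻¹.val) * h.val) k l =
      (h⁻¹.val * g.val) k i * a * (g⁻¹.val * h.val) j l := by
    rw [← mul_single_mul_apply]
    simp only [mul_assoc]
  have hle := mem_ord.mp hmem k l
  rw [hentry, map_mul, map_mul] at hle
  rwa [mul_comm (v _) (v a), mul_assoc, mul_comm (v ((h⁻¹.val * g.val) k i))] at hle

theorem isNear_one_of_ord_eq [Nonempty n] (hv : IsIntegerValuation K v π)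
    (H : hv.ord g = hv.ord h) : IsNear v 1 g h := by
  rw [← map_one v]
  refine hv.isNear_of_forall_mem_ord fun x hx => ?_
  rw [← H, mem_ord]
  rwa [map_one] at hx

theorem lat_mul_diagUnit_lt (hv : IsIntegerValuation K v π) (g : (Matrix n n B)ˣ) {a : n → Bˣ}
    (ha : ∀ i, v (a i) ≤ 1) {i : n} (hi : v (a i) < 1) :
    hv.lat (g * diagUnit n B a) < hv.lat g := by
  rw [lt_iff_le_not_ge, lat_le_lat_iff, lat_le_lat_iff, mul_inv_rev, Units.val_mul, Units.val_mul,
    Units.inv_mul_cancel_left, Units.inv_mul_cancel_right, val_diagUnit, val_inv_diagUnit]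
  refine ⟨entriesLE_diagonal ha, fun h => not_le.mpr hi ?_⟩
  have hinv := h i i
  rw [Matrix.diagonal_apply_eq, Units.val_inv_eq_inv_val, map_inv₀] at hinv
  exact (inv_le_one₀ (by simp [zero_lt_iff])).mp hinv

end Ord

/-- The uniformizer as a unit of `B`. -/
def unif (hv : IsIntegerValuation K v π) : Bˣ := Units.mk0 π hv.ne_zero

/-- The matrix `diag(π ^ s, 1)`. -/
def diagPow (hv : IsIntegerValuation K v π) (s : ℕ) : (Matrix (Fin 2) (Fin 2) B)ˣ :=
  diagUnit (Fin 2) B ![hv.unif ^ s, 1]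

theorem val_diagPow (hv : IsIntegerValuation K v π) (s : ℕ) :
    (hv.diagPow s).val = !![π ^ s, 0; 0, 1] := by
  simp [diagPow, val_diagUnit, Matrix.diagonal_fin_two, unif]

theorem val_inv_diagPow (hv : IsIntegerValuation K v π) (s : ℕ) :
    (hv.diagPow s)⁻¹.val = !![(π ^ s)⁻¹, 0; 0, 1] := by
  simp [diagPow, val_inv_diagUnit, Matrix.diagonal_fin_two, unif]

theorem diagPow_zero (hv : IsIntegerValuation K v π) : hv.diagPow 0 = 1 := by
  ext i j
  fin_cases i <;> fin_cases j <;> simp [val_diagPow]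

theorem diagPow_succ (hv : IsIntegerValuation K v π) (s : ℕ) :
    hv.diagPow (s + 1) = hv.diagPow s * hv.diagPow 1 := by
  rw [diagPow, diagPow, diagPow, ← map_mul]
  congr 1
  ext i
  fin_cases i <;> simp [pow_succ]

theorem exists_ord_eq_ord_mul_diagPow (hv : IsIntegerValuation K v π)
    (g h : (Matrix (Fin 2) (Fin 2) B)ˣ) :
    ∃ k ∈ integralGL (Fin 2) v, ∃ s, hv.ord h = hv.ord (g * k * hv.diagPow s) := by
  obtain ⟨k, hk, l, hl, a, ha, hkal⟩ := exists_eq_mul_diagUnit_mul v (g⁻¹ * h)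
  obtain ⟨s, hs⟩ : ∃ s, v (a 0 * ↑(a 1)⁻¹) = v π ^ s := by
    refine hv.exists_pow (by simp) ?_
    rw [map_mul, Units.val_inv_eq_inv_val, map_inv₀]
    exact mul_inv_le_one_of_le₀ ha zero_le
  let u : Bˣ := a 0 * (a 1)⁻¹ * (hv.unif ^ s)⁻¹
  have hu : v u = 1 := by
    have hπ : v ↑(hv.unif ^ s)⁻¹ = (v π ^ s)⁻¹ := by simp [unif]
    rw [Units.val_mul, map_mul, Units.val_mul, hs, hπ]
    exact mul_inv_cancel₀ (pow_ne_zero _ hv.val_pos.ne')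
  have hdiag : diagUnit (Fin 2) B a =
      diagUnit (Fin 2) B ![u, 1] * hv.diagPow s * diagUnit (Fin 2) B fun _ => a 1 := by
    rw [diagPow, ← map_mul, ← map_mul]
    congr 1
    ext i
    fin_cases i <;> simp [u]
  have hu' : diagUnit (Fin 2) B ![u, 1] ∈ integralGL (Fin 2) v :=
    diagUnit_mem_integralGL (Fin.forall_fin_two.mpr ⟨hu, by simp⟩)
  refine ⟨k * diagUnit (Fin 2) B ![u, 1], mul_mem hk hu', s, ?_⟩
  rw [inv_mul_eq_iff_eq_mul.mp hkal, hdiag, ← mul_assoc, ord_mul_of_mem_integralGL hv _ hl]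
  simp only [← mul_assoc]
  rw [ord_mul_scalar]

theorem le_of_isNear_mul_diagPow (hv : IsIntegerValuation K v π)
    {g : (Matrix (Fin 2) (Fin 2) B)ˣ} {s t : ℕ} (H : IsNear v (v π ^ t) g (g * hv.diagPow s)) :
    s ≤ t := by
  obtain ⟨δ, ε, hδ, hε, hle⟩ := H
  rw [Units.val_mul, Units.inv_mul_cancel_left, val_diagPow] at hδ
  rw [mul_inv_rev, Units.val_mul, Units.inv_mul_cancel_right, val_inv_diagPow] at hε
  have hδ' : 1 ≤ δ := by simpa using hδ 1 1
  have hε' : (v π ^ s)⁻¹ ≤ ε := by simpa using hε 0 0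
  have hpos : 0 < v π ^ s := pow_pos hv.val_pos s
  refine (pow_le_pow_iff_right_of_lt_one₀ hv.val_pos hv.lt_one).mp ?_
  rw [← div_le_one₀ hpos, div_eq_mul_inv]
  exact (mul_le_mul_right (hε'.trans (le_mul_of_one_le_left' hδ')) _).trans hle

theorem exists_ord_eq_of_isNear (hv : IsIntegerValuation K v π)
    {g h : (Matrix (Fin 2) (Fin 2) B)ˣ} {t : ℕ} (H : IsNear v (v π ^ t) g h) :
    ∃ k ∈ integralGL (Fin 2) v, ∃ s ≤ t, hv.ord h = hv.ord (g * k * hv.diagPow s) := by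
  obtain ⟨k, hk, s, hs⟩ := hv.exists_ord_eq_ord_mul_diagPow g h
  refine ⟨k, hk, s, hv.le_of_isNear_mul_diagPow (g := g * k) ?_, hs⟩
  have hgk : IsNear v 1 (g * k) g := hv.isNear_one_of_ord_eq (hv.ord_mul_of_mem_integralGL g hk)
  simpa using (hgk.trans H).trans (hv.isNear_one_of_ord_eq hs)

theorem latticeMulMaxIdeal_lat (hv : IsIntegerValuation K v π)
    (g : (Matrix (Fin 2) (Fin 2) B)ˣ) :
    latticeMulMaxIdeal (hv.lat g) = hv.lat (g * diagUnit (Fin 2) B fun _ => hv.unif) := by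
  have hmem : ∀ w, w ∈ hv.lat (g * diagUnit (Fin 2) B fun _ => hv.unif) ↔
      ∀ i, v ((g⁻¹.val.mulVec w) i) ≤ v π := by
    intro w
    rw [mem_lat]
    refine forall_congr' fun i => ?_
    rw [mul_inv_rev, Units.val_mul, ← Matrix.mulVec_mulVec, val_inv_diagUnit,
      Matrix.mulVec_diagonal, map_mul, Units.val_inv_eq_inv_val, map_inv₀,
      inv_mul_le_one₀ (zero_lt_iff.mpr (by simp))]
    rfl
  refine le_antisymm (Submodule.span_le.mpr ?_) fun w hw => ?_
  · rintro _ ⟨w, hw, b, hb, rfl⟩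
    rw [SetLike.mem_coe, hmem]
    intro i
    rw [Matrix.mulVec_smul, Pi.smul_apply, MulOpposite.smul_eq_mul_unop, map_mul]
    exact mul_le_of_le_one_of_le (mem_lat.mp hw i) (hv.le_of_lt_one (hv.mem_maxIdeal_iff.mp hb))
  · rw [hmem] at hw
    refine Submodule.subset_span ⟨MulOpposite.op π⁻¹ • w, mem_lat.mpr fun i => ?_, π,
      hv.mem_maxIdeal_iff.mpr hv.lt_one, ?_⟩
    · rw [Matrix.mulVec_smul, Pi.smul_apply, MulOpposite.smul_eq_mul_unop, map_mul,
        MulOpposite.unop_op, map_inv₀]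
      exact mul_inv_le_one_of_le₀ (hw i) zero_le
    · rw [smul_smul, ← MulOpposite.op_mul, inv_mul_cancel₀ hv.ne_zero, MulOpposite.op_one, one_smul]

theorem isNear_of_le_of_le (hv : IsIntegerValuation K v π) {g h : (Matrix (Fin 2) (Fin 2) B)ˣ}
    (H : latticeMulMaxIdeal (hv.lat g) ≤ hv.lat h) (H' : hv.lat h ≤ hv.lat g) :
    IsNear v (v π) g h := by
  rw [latticeMulMaxIdeal_lat, lat_le_lat_iff, Units.val_mul, ← mul_assoc,
    entriesLE_mul_scalar_iff, one_mul] at H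
  refine ⟨1, _, lat_le_lat_iff.mp H', H, ?_⟩
  rw [one_mul]
  exact (mul_inv_cancel₀ hv.val_pos.ne').le

variable [IsNoetherianRing 𝒪[K]]

theorem isNear_of_adj (hv : IsIntegerValuation K v π) {D D' : Vertex K B}
    (hadj : (tree K B).Adj D D') {g h : (Matrix (Fin 2) (Fin 2) B)ˣ} (hg : D.1 = hv.ord g)
    (hh : D'.1 = hv.ord h) : IsNear v (v π) g h := by
  have hnear : ∀ {E E' : Vertex K B} {g h : (Matrix (Fin 2) (Fin 2) B)ˣ}, E.1 = hv.ord g →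
      E'.1 = hv.ord h → (∃ L L' : Submodule 𝒪[K] (Fin 2 → B), IsLattice L ∧ IsLattice L' ∧
        IsEndOf E.1 L ∧ IsEndOf E'.1 L' ∧ latticeMulMaxIdeal L < L' ∧ L' < L) →
      IsNear v (v π) g h := by
    rintro E E' g h hg hh ⟨L, L', hL, hL', hE, hE', hlt, hlt'⟩
    obtain ⟨g₁, rfl⟩ := hv.exists_eq_lat hL
    obtain ⟨h₁, rfl⟩ := hv.exists_eq_lat hL'
    have hgg₁ := hv.isNear_one_of_ord_eq (hg.symm.trans (isEndOf_lat_iff.mp hE))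
    have hhh₁ := hv.isNear_one_of_ord_eq (hh.symm.trans (isEndOf_lat_iff.mp hE'))
    simpa using (hgg₁.trans (hv.isNear_of_le_of_le hlt.le hlt'.le)).trans hhh₁.symm
  rcases hadj.2 with h | h
  · exact hnear hg hh h
  · exact (hnear hh hg h).symm

theorem isNear_of_walk (hv : IsIntegerValuation K v π) {D D' : Vertex K B}
    (p : (tree K B).Walk D D') {g h : (Matrix (Fin 2) (Fin 2) B)ˣ} (hg : D.1 = hv.ord g)
    (hh : D'.1 = hv.ord h) : IsNear v (v π ^ p.length) g h := by
  induction p generalizing g with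
  | nil =>
    rw [SimpleGraph.Walk.length_nil, pow_zero]
    exact hv.isNear_one_of_ord_eq (hg.symm.trans hh)
  | @cons _ D'' _ hadj p ih =>
    obtain ⟨i, hi⟩ := hv.exists_eq_ord D''.2
    rw [SimpleGraph.Walk.length_cons, pow_succ']
    exact (hv.isNear_of_adj hadj hg hi).trans (ih hi hh)

/-- The vertex of the tree attached to an invertible matrix. -/
noncomputable def vertex (hv : IsIntegerValuation K v π) (g : (Matrix (Fin 2) (Fin 2) B)ˣ) :
    Vertex K B :=
  ⟨hv.ord g, hv.isMaximalOrder_ord g⟩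

theorem edist_vertex_mul_diagPow_one_le (hv : IsIntegerValuation K v π)
    (g : (Matrix (Fin 2) (Fin 2) B)ˣ) :
    (tree K B).edist (hv.vertex g) (hv.vertex (g * hv.diagPow 1)) ≤ 1 := by
  rw [SimpleGraph.edist_le_one_iff_adj_or_eq, or_iff_not_imp_right]
  refine fun hne => ⟨hne, Or.inl ⟨hv.lat g, hv.lat (g * hv.diagPow 1), hv.isLattice_lat _,
    hv.isLattice_lat _, isEndOf_lat_iff.mpr rfl, isEndOf_lat_iff.mpr rfl, ?_, ?_⟩⟩
  · have hmul : g * diagUnit (Fin 2) B (fun _ => hv.unif) =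
        g * hv.diagPow 1 * diagUnit (Fin 2) B ![1, hv.unif] := by
      rw [diagPow, mul_assoc, ← map_mul]
      congr 2
      ext i
      fin_cases i <;> simp
    rw [latticeMulMaxIdeal_lat, hmul]
    exact hv.lat_mul_diagUnit_lt _ (i := 1)
      (Fin.forall_fin_two.mpr ⟨(map_one v).le, hv.lt_one.le⟩) hv.lt_one
  · rw [diagPow, pow_one]
    exact hv.lat_mul_diagUnit_lt _ (i := 0)
      (Fin.forall_fin_two.mpr ⟨hv.lt_one.le, (map_one v).le⟩) hv.lt_one

theorem edist_vertex_mul_diagPow_le (hv : IsIntegerValuation K v π)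
    (g : (Matrix (Fin 2) (Fin 2) B)ˣ) (s : ℕ) :
    (tree K B).edist (hv.vertex g) (hv.vertex (g * hv.diagPow s)) ≤ s := by
  induction s with
  | zero => simp [diagPow_zero]
  | succ s ih =>
    refine (SimpleGraph.edist_triangle (v := hv.vertex (g * hv.diagPow s))).trans ?_
    rw [diagPow_succ, ← mul_assoc, Nat.cast_add, Nat.cast_one]
    exact add_le_add ih (hv.edist_vertex_mul_diagPow_one_le _)

theorem edist_vertex_le_iff (hv : IsIntegerValuation K v π) {g h : (Matrix (Fin 2) (Fin 2) B)ˣ}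
    {t : ℕ} : (tree K B).edist (hv.vertex g) (hv.vertex h) ≤ t ↔ IsNear v (v π ^ t) g h := by
  constructor
  · intro H
    obtain ⟨p, hp⟩ :=
      SimpleGraph.exists_walk_of_edist_ne_top (H.trans_lt (ENat.natCast_lt_top t)).ne
    rw [← hp] at H
    exact (hv.isNear_of_walk p rfl rfl).mono
      (pow_le_pow_right_of_le_one' hv.lt_one.le (by exact_mod_cast H))
  · intro H
    obtain ⟨k, hk, s, hst, hs⟩ := hv.exists_ord_eq_of_isNear H
    have hg : hv.vertex g = hv.vertex (g * k) :=
      Subtype.ext (hv.ord_mul_of_mem_integralGL g hk).symm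
    have hh : hv.vertex h = hv.vertex (g * k * hv.diagPow s) := Subtype.ext hs
    rw [hg, hh]
    exact (hv.edist_vertex_mul_diagPow_le _ s).trans (by exact_mod_cast hst)

end IsIntegerValuation

end Tree

section Bracket

section Commutator

variable {B Γ : Type*} [Ring B] [LinearOrderedCommMonoidWithZero Γ] {v : Valuation B Γ} {γ : Γ}
  {y z : Matrix (Fin 2) (Fin 2) B}

theorem inv_upperUnit_mul_mul_upperUnit_apply (b : B) (y : Matrix (Fin 2) (Fin 2) B) :
    ((upperUnit b)⁻¹.val * y * (upperUnit b).val) 0 1 =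
      (y 0 0 * b - b * y 1 1) + (y 0 1 - b * y 1 0 * b) := by
  change (!![1, -b; 0, 1] * y * !![1, b; 0, 1] : Matrix (Fin 2) (Fin 2) B) 0 1 = _
  simp only [Matrix.mul_apply, Fin.sum_univ_two, Matrix.of_apply, Matrix.cons_val_zero,
    Matrix.cons_val_one, Matrix.cons_val_fin_one]
  noncomm_ring

theorem apply_one_zero_le_of_forall_conj
    (h : ∀ k ∈ integralGL (Fin 2) v, v ((k⁻¹.val * y * k.val) 0 1) ≤ γ) : v (y 1 0) ≤ γ := by
  have hswap := h (swapUnit B 0 1) (swapUnit_mem_integralGL 0 1)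
  have hval : (swapUnit B (0 : Fin 2) 1).val = Matrix.swap B 0 1 := rfl
  have hinv : (swapUnit B (0 : Fin 2) 1)⁻¹.val = Matrix.swap B 0 1 := rfl
  simpa [hval, hinv] using hswap

theorem map_mul_sub_mul_le_of_forall_conj
    (h : ∀ k ∈ integralGL (Fin 2) v, v ((k⁻¹.val * y * k.val) 0 1) ≤ γ) {b : B} (hb : v b ≤ 1) :
    v (y 0 0 * b - b * y 1 1) ≤ γ := by
  have h01 : v (y 0 1) ≤ γ := by simpa using h 1 (one_mem _)
  have hoff : v (y 0 1 - b * y 1 0 * b) ≤ γ := by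
    refine v.map_sub_le h01 ?_
    rw [map_mul, map_mul]
    exact mul_le_of_le_of_le_one
      (mul_le_of_le_one_of_le hb (apply_one_zero_le_of_forall_conj h)) hb
  have hupper := h (upperUnit b) (upperUnit_mem_integralGL hb)
  rw [inv_upperUnit_mul_mul_upperUnit_apply] at hupper
  simpa using v.map_sub_le hupper hoff

theorem entriesLE_sub_scalar_of_forall_conj
    (h : ∀ k ∈ integralGL (Fin 2) v, v ((k⁻¹.val * y * k.val) 0 1) ≤ γ) :
    EntriesLE v γ (y - Matrix.scalar (Fin 2) (y 0 0)) := by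
  rw [Matrix.eta_fin_two (y - _)]
  refine entriesLE_of_fin_two (by simp) ?_ ?_ ?_
  · simpa using h 1 (one_mem _)
  · simpa using apply_one_zero_le_of_forall_conj h
  · simpa [v.map_sub_swap] using map_mul_sub_mul_le_of_forall_conj h (map_one v).le

theorem map_commutator_le_of_forall_conj
    (h : ∀ k ∈ integralGL (Fin 2) v, v ((k⁻¹.val * y * k.val) 0 1) ≤ γ) {b : B} (hb : v b ≤ 1) :
    v (y 0 0 * b - b * y 0 0) ≤ γ := by
  have hdiag : v (y 0 0 - y 1 1) ≤ γ := by
    simpa using map_mul_sub_mul_le_of_forall_conj h (map_one v).le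
  have hsplit : y 0 0 * b - b * y 0 0 = (y 0 0 * b - b * y 1 1) - b * (y 0 0 - y 1 1) := by
    noncomm_ring
  rw [hsplit]
  refine v.map_sub_le (map_mul_sub_mul_le_of_forall_conj h hb) ?_
  rw [map_mul]
  exact mul_le_of_le_one_of_le hb hdiag

theorem entriesLE_commutator_of_forall_conj
    (h : ∀ k ∈ integralGL (Fin 2) v, v ((k⁻¹.val * y * k.val) 0 1) ≤ γ) (hz : EntriesLE v 1 z) :
    EntriesLE v γ (y * z - z * y) := by
  let a := Matrix.scalar (Fin 2) (y 0 0)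
  have hya : EntriesLE v γ (y - a) := entriesLE_sub_scalar_of_forall_conj h
  have haz : EntriesLE v γ (a * z - z * a) := fun i j => by
    simp only [a, Matrix.sub_apply, Matrix.scalar_apply, Matrix.diagonal_mul, Matrix.mul_diagonal]
    exact map_commutator_le_of_forall_conj h (hz i j)
  have hsplit : y * z - z * y = (a * z - z * a) + ((y - a) * z - z * (y - a)) := by
    noncomm_ring
  rw [hsplit]
  exact haz.add ((hya.mul_of_le hz (mul_one γ).le).sub (hz.mul_of_le hya (one_mul γ).le))

end Commutator

variable {K : Type*} [Field K] [ValuativeRel K] {B : Type*} [DivisionRing B] [Algebra K B]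
  {Γ : Type*} [LinearOrderedCommGroupWithZero Γ] {v : Valuation B Γ} {π : B}

namespace IsIntegerValuation

section Ideals

variable {n : Type*} [Fintype n] [DecidableEq n]

/-- Conjugation by `g` as an isomorphism from the order `g M_n(𝒪_B) g⁻¹` to `M_n(𝒪_B)`. -/
def ordEquiv (hv : IsIntegerValuation K v π) (g : (Matrix n n B)ˣ) :
    hv.ord g ≃+* hv.integralMatrices n where
  toFun x := ⟨g⁻¹.val * x.1 * g.val, mem_ord.mp x.2⟩
  invFun z := ⟨g.val * z.1 * g⁻¹.val, mem_ord.mpr <| by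
    have hz : EntriesLE v 1 z.1 := z.2
    simpa [mul_assoc] using hz⟩
  left_inv x := by simp [mul_assoc]
  right_inv z := by simp [mul_assoc]
  map_mul' x y := by simp [mul_assoc]
  map_add' x y := by ext1; simp [mul_add, add_mul]

/-- The ideal of `M_n(𝒪_B)` of the matrices whose entries have valuation at most `γ`. -/
def entriesIdeal (hv : IsIntegerValuation K v π) (n : Type*) [Fintype n] [DecidableEq n] (γ : Γ) :
    Ideal (hv.integralMatrices n) where
  carrier := {z | EntriesLE v γ z.1}
  add_mem' := EntriesLE.add
  zero_mem' := entriesLE_zero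
  smul_mem' z _ hw := z.2.mul_of_le hw (one_mul γ).le

instance isTwoSided_entriesIdeal (hv : IsIntegerValuation K v π) (γ : Γ) :
    (hv.entriesIdeal n γ).IsTwoSided where
  mul_mem_of_left w hz := EntriesLE.mul_of_le hz w.2 (mul_one γ).le

/-- The ideal `g π ^ t M_n(𝒪_B) g⁻¹` of the order `g M_n(𝒪_B) g⁻¹`. -/
noncomputable def levelIdeal (hv : IsIntegerValuation K v π) (g : (Matrix n n B)ˣ) (t : ℕ) :
    Ideal (hv.ord g) :=
  (hv.entriesIdeal n (v π ^ t)).comap (hv.ordEquiv g)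

theorem mem_levelIdeal {hv : IsIntegerValuation K v π} {g : (Matrix n n B)ˣ} {t : ℕ}
    {x : hv.ord g} : x ∈ hv.levelIdeal g t ↔ EntriesLE v (v π ^ t) (hv.ordEquiv g x).1 := Iff.rfl

instance isTwoSided_levelIdeal (hv : IsIntegerValuation K v π) (g : (Matrix n n B)ˣ) (t : ℕ) :
    (hv.levelIdeal g t).IsTwoSided :=
  inferInstanceAs ((hv.entriesIdeal n (v π ^ t)).comap (hv.ordEquiv g)).IsTwoSided

theorem levelIdeal_one_ne_top [Nonempty n] (hv : IsIntegerValuation K v π) (g : (Matrix n n B)ˣ) :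
    hv.levelIdeal g 1 ≠ ⊤ := by
  obtain ⟨i⟩ := ‹Nonempty n›
  rw [Ideal.ne_top_iff_one, mem_levelIdeal, map_one, pow_one]
  exact fun h => hv.lt_one.not_ge (by simpa using h i i)

theorem eq_top_of_map_apply_eq_one (hv : IsIntegerValuation K v π)
    {J : Ideal (hv.integralMatrices n)} [J.IsTwoSided] {z : hv.integralMatrices n} (hz : z ∈ J)
    {i j : n} (hij : v (z.1 i j) = 1) : J = ⊤ := by
  let e : n → n → hv.integralMatrices n := fun k l =>
    ⟨Matrix.single k l 1, entriesLE_single (map_one v).le k l⟩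
  have hinv : v (z.1 i j)⁻¹ ≤ 1 := by rw [map_inv₀, hij, inv_one]
  let c : hv.integralMatrices n := ⟨Matrix.scalar n (z.1 i j)⁻¹, entriesLE_diagonal fun _ => hinv⟩
  have hne : z.1 i j ≠ 0 := (v.ne_zero_iff).mp (hij ▸ one_ne_zero)
  have hone : c * ∑ k, e k i * z * e j k = 1 := by
    ext1
    change Matrix.scalar n (z.1 i j)⁻¹ * (∑ k, e k i * z * e j k : hv.integralMatrices n).1 = 1
    have hsum : (∑ k, e k i * z * e j k : hv.integralMatrices n).1 =
        Matrix.scalar n (z.1 i j) := by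
      rw [← sum_single_mul_mul_single, AddSubmonoidClass.coe_finsetSum]
      rfl
    rw [hsum, ← map_mul, inv_mul_cancel₀ hne, map_one]
  rw [Ideal.eq_top_iff_one, ← hone]
  exact J.mul_mem_left _ (sum_mem fun k _ => J.mul_mem_right _ (J.mul_mem_left _ hz))

theorem le_levelIdeal_one (hv : IsIntegerValuation K v π) {g : (Matrix n n B)ˣ}
    {J : Ideal (hv.ord g)} [J.IsTwoSided] (hJ : J ≠ ⊤) : J ≤ hv.levelIdeal g 1 := by
  intro x hx
  rw [mem_levelIdeal, pow_one]
  refine fun i j => hv.le_of_lt_one (((hv.ordEquiv g x).2 i j).lt_of_ne fun hij => hJ ?_)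
  have hcomap : J.comap (hv.ordEquiv g).symm = ⊤ :=
    hv.eq_top_of_map_apply_eq_one (by simpa [Ideal.mem_comap] using hx) hij
  exact Ideal.comap_eq_top_iff.mp hcomap

theorem isMaximalBilateral_iff [Nonempty n] {hv : IsIntegerValuation K v π} {g : (Matrix n n B)ˣ}
    {I : Ideal (hv.ord g)} : IsMaximalBilateral I ↔ I = hv.levelIdeal g 1 := by
  have hmax : IsMaximalBilateral (hv.levelIdeal g 1) := by
    refine ⟨⟨inferInstance, hv.levelIdeal_one_ne_top g⟩, fun J ⟨_, hJ⟩ _ => ?_⟩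
    exact hv.le_levelIdeal_one hJ
  refine ⟨fun h => ?_, fun h => h ▸ hmax⟩
  have := h.1.1
  exact h.eq_of_le hmax.1 (hv.le_levelIdeal_one h.1.2)

theorem maximalBilateral_ord [Nonempty n] (hv : IsIntegerValuation K v π) (g : (Matrix n n B)ˣ) :
    maximalBilateral (hv.ord g) = hv.levelIdeal g 1 := by
  simp only [maximalBilateral, isMaximalBilateral_iff, Set.ofPred_eq_eq_singleton, sInf_singleton]

theorem levelIdeal_zero (hv : IsIntegerValuation K v π) (g : (Matrix n n B)ˣ) :
    hv.levelIdeal g 0 = ⊤ := by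
  refine eq_top_iff.mpr fun x _ => ?_
  rw [mem_levelIdeal, pow_zero]
  exact (hv.ordEquiv g x).2

theorem exists_eq_mul_of_mem_levelIdeal_succ {hv : IsIntegerValuation K v π}
    {g : (Matrix n n B)ˣ} {t : ℕ} {x : hv.ord g} (hx : x ∈ hv.levelIdeal g (t + 1)) :
    ∃ y ∈ hv.levelIdeal g t, ∃ z ∈ hv.levelIdeal g 1, x = y * z := by
  let p : (Matrix n n B)ˣ := diagUnit n B fun _ => hv.unif
  have hy : EntriesLE v (v π ^ t) ((hv.ordEquiv g x).1 * p⁻¹.val) := by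
    rw [show p⁻¹ = diagUnit n B fun _ => hv.unif⁻¹ from (map_inv _ _).symm,
      entriesLE_mul_scalar_iff]
    simpa [unif, ← pow_succ] using mem_levelIdeal.mp hx
  have hz : EntriesLE v (v π ^ 1) p.val := entriesLE_diagonal fun _ => (pow_one (v π)).ge
  refine ⟨(hv.ordEquiv g).symm ⟨_, hy.mono (pow_le_one' hv.lt_one.le t)⟩, ?_,
    (hv.ordEquiv g).symm ⟨_, hz.mono (pow_le_one' hv.lt_one.le 1)⟩, ?_, ?_⟩
  · rwa [mem_levelIdeal, RingEquiv.apply_symm_apply]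
  · rwa [mem_levelIdeal, RingEquiv.apply_symm_apply]
  · rw [← map_mul, RingEquiv.eq_symm_apply]
    ext1
    exact (Units.inv_mul_cancel_right _ p).symm

theorem levelIdeal_one_pow (hv : IsIntegerValuation K v π) (g : (Matrix n n B)ˣ) (t : ℕ) :
    hv.levelIdeal g 1 ^ t = hv.levelIdeal g t := by
  induction t with
  | zero => rw [Submodule.pow_zero, Ideal.one_eq_top, levelIdeal_zero]
  | succ t ih =>
    rw [Submodule.pow_succ, ih]
    refine le_antisymm (Ideal.mul_le.mpr fun x hx y hy => ?_) fun x hx => ?_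
    · rw [mem_levelIdeal, map_mul]
      exact EntriesLE.mul_of_le hx hy (by rw [pow_one, pow_succ])
    · obtain ⟨y, hy, z, hz, rfl⟩ := exists_eq_mul_of_mem_levelIdeal_succ hx
      exact Ideal.mul_mem_mul hy hz

end Ideals

theorem mk_mem_center_iff {hv : IsIntegerValuation K v π} {g : (Matrix (Fin 2) (Fin 2) B)ˣ} {t : ℕ}
    {x : hv.ord g} : Ideal.Quotient.mk (maximalBilateral (hv.ord g) ^ t) x ∈
      Subring.center (hv.ord g ⧸ maximalBilateral (hv.ord g) ^ t) ↔
      ∀ y : hv.ord g, x * y - y * x ∈ hv.levelIdeal g t := by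
  rw [Subring.mem_center_iff, Ideal.Quotient.mk_surjective.forall]
  refine forall_congr' fun y => ?_
  rw [eq_comm, ← map_mul, ← map_mul, Ideal.Quotient.mk_eq_mk_iff_sub_mem, maximalBilateral_ord,
    levelIdeal_one_pow]

theorem mem_bracket_iff {hv : IsIntegerValuation K v π} {g : (Matrix (Fin 2) (Fin 2) B)ˣ} {t : ℕ}
    {x : Matrix (Fin 2) (Fin 2) B} : x ∈ bracket (hv.ord g) t ↔
      x ∈ hv.ord g ∧ ∀ z, EntriesLE v 1 z →
        EntriesLE v (v π ^ t) (g⁻¹.val * x * g.val * z - z * (g⁻¹.val * x * g.val)) := by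
  refine Iff.trans (exists_congr fun hx => ?_) exists_prop
  rw [mk_mem_center_iff, (hv.ordEquiv g).symm.surjective.forall, Subtype.forall]
  refine forall₂_congr fun z hz => ?_
  rw [mem_levelIdeal, map_sub, map_mul, map_mul, RingEquiv.apply_symm_apply]
  rfl

theorem mem_bracket_of_entriesLE {hv : IsIntegerValuation K v π}
    {g : (Matrix (Fin 2) (Fin 2) B)ˣ} {t : ℕ} {x : Matrix (Fin 2) (Fin 2) B}
    (hx : EntriesLE v (v π ^ t) (g⁻¹.val * x * g.val)) : x ∈ bracket (hv.ord g) t :=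
  mem_bracket_iff.mpr ⟨hx.mono (pow_le_one' hv.lt_one.le t), fun _ hz =>
    (hx.mul_of_le hz (mul_one _).le).sub (hz.mul_of_le hx (one_mul _).le)⟩

theorem mem_ord_mul_mul_diagPow_of_mem_bracket {hv : IsIntegerValuation K v π}
    {g k : (Matrix (Fin 2) (Fin 2) B)ˣ} {s t : ℕ} {x : Matrix (Fin 2) (Fin 2) B}
    (hx : x ∈ bracket (hv.ord g) t) (hk : k ∈ integralGL (Fin 2) v) (hst : s ≤ t) :
    x ∈ hv.ord (g * k * hv.diagPow s) := by
  obtain ⟨hxg, hcomm⟩ := mem_bracket_iff.mp hx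
  let y := g⁻¹.val * x * g.val
  let z := k * hv.diagPow s
  have hz : EntriesLE v 1 z.val := by
    rw [Units.val_mul, entriesLE_mul_left_iff hk, val_diagPow]
    exact entriesLE_of_fin_two (by simp [pow_le_one', hv.lt_one.le]) (by simp) (by simp) (by simp)
  have hz' : EntriesLE v (v π ^ s)⁻¹ z⁻¹.val := by
    have hle : 1 ≤ (v π ^ s)⁻¹ :=
      (one_le_inv₀ (pow_pos hv.val_pos s)).mpr (pow_le_one' hv.lt_one.le s)
    rw [mul_inv_rev, Units.val_mul, entriesLE_mul_right_iff (inv_mem hk), val_inv_diagPow]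
    exact entriesLE_of_fin_two (by simp) (by simp) (by simp) (by simpa using hle)
  have hcancel : (v π ^ s)⁻¹ * v π ^ t ≤ 1 := by
    rw [inv_mul_le_one₀ (pow_pos hv.val_pos s)]
    exact pow_le_pow_right_of_le_one' hv.lt_one.le hst
  have hsplit : z⁻¹.val * y * z.val = z⁻¹.val * (y * z.val - z.val * y) + y := by
    rw [mul_sub, Units.inv_mul_cancel_left, mul_assoc, sub_add_cancel]
  rw [mem_ord, mul_assoc g, inv_val_mul_mul_val_mul, hsplit]
  exact (hz'.mul_of_le (hcomm _ hz) hcancel).add hxg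

theorem inv_diagPow_mul_mul_diagPow_apply (hv : IsIntegerValuation K v π) (s : ℕ)
    (x : Matrix (Fin 2) (Fin 2) B) :
    ((hv.diagPow s)⁻¹.val * x * (hv.diagPow s).val) 0 1 = (π ^ s)⁻¹ * x 0 1 := by
  simp only [val_diagPow, val_inv_diagPow, Matrix.mul_apply, Fin.sum_univ_two]
  simp

theorem mem_intersectionOrder_closedBall {D : Vertex K B} {t : ℕ}
    {x : Matrix (Fin 2) (Fin 2) B} : x ∈ intersectionOrder (closedBall D t) ↔
      ∀ E : Vertex K B, (tree K B).edist D E ≤ t → x ∈ E.1 := by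
  simp only [intersectionOrder, Algebra.mem_iInf]
  rfl

variable [IsNoetherianRing 𝒪[K]]

theorem intersectionOrder_closedBall (hv : IsIntegerValuation K v π)
    (g : (Matrix (Fin 2) (Fin 2) B)ˣ) (t : ℕ) :
    (intersectionOrder (closedBall (hv.vertex g) t) : Set (Matrix (Fin 2) (Fin 2) B)) =
      bracket (hv.ord g) t := by
  ext x
  rw [SetLike.mem_coe, mem_intersectionOrder_closedBall]
  refine ⟨fun h => mem_bracket_iff.mpr ⟨h (hv.vertex g) (by simp), fun z hz =>
    entriesLE_commutator_of_forall_conj (fun k hk => ?_) hz⟩, fun hx D hD => ?_⟩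
  · have hvertex : hv.vertex g = hv.vertex (g * k) :=
      Subtype.ext (hv.ord_mul_of_mem_integralGL g hk).symm
    have hmem := h (hv.vertex (g * k * hv.diagPow t))
      (hvertex ▸ hv.edist_vertex_mul_diagPow_le (g * k) t)
    have hentry := mem_ord.mp hmem 0 1
    rwa [inv_val_mul_mul_val_mul, inv_val_mul_mul_val_mul, inv_diagPow_mul_mul_diagPow_apply,
      map_mul, map_inv₀, map_pow, inv_mul_le_one₀ (pow_pos hv.val_pos t)] at hentry
  · obtain ⟨h, hh⟩ := hv.exists_eq_ord D.2
    obtain rfl : D = hv.vertex h := Subtype.ext hh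
    obtain ⟨k, hk, s, hst, hs⟩ := hv.exists_ord_eq_of_isNear (hv.edist_vertex_le_iff.mp hD)
    rw [hh, hs]
    exact mem_ord_mul_mul_diagPow_of_mem_bracket hx hk hst

theorem intersectionOrder_closedBall_le_iff (hv : IsIntegerValuation K v π)
    {g : (Matrix (Fin 2) (Fin 2) B)ˣ} {t : ℕ} {D : Vertex K B} :
    intersectionOrder (closedBall (hv.vertex g) t) ≤ D.1 ↔
      (tree K B).edist (hv.vertex g) D ≤ t := by
  refine ⟨fun hle => ?_, fun hD x hx => mem_intersectionOrder_closedBall.mp hx D hD⟩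
  obtain ⟨h, hh⟩ := hv.exists_eq_ord D.2
  obtain rfl : D = hv.vertex h := Subtype.ext hh
  rw [edist_vertex_le_iff, ← map_pow]
  refine hv.isNear_of_forall_mem_ord fun x hx => hle ?_
  rw [map_pow] at hx
  rw [← SetLike.mem_coe, intersectionOrder_closedBall]
  exact mem_bracket_of_entriesLE hx

theorem isAdmissible_closedBall (hv : IsIntegerValuation K v π)
    (g : (Matrix (Fin 2) (Fin 2) B)ˣ) (t : ℕ) : IsAdmissible (closedBall (hv.vertex g) t) := by
  refine ⟨intersectionOrder (closedBall (hv.vertex g) t), ?_, ?_⟩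
  · have hfg := (hv.isFullOrder_ord g).1
    have : IsNoetherian 𝒪[K] (Subalgebra.toSubmodule (hv.ord g)) :=
      isNoetherian_of_fg_of_noetherian _ hfg
    exact Submodule.FG.of_le hfg fun x hx =>
      mem_intersectionOrder_closedBall.mp hx (hv.vertex g) (by simp)
  · simp only [branch, hv.intersectionOrder_closedBall_le_iff]
    rfl

end IsIntegerValuation

end Bracket

theorem mainTheorem6_general {K : Type*} [Field K] [ValuativeRel K] [IsNoetherianRing 𝒪[K]]
    {B : Type*} [DivisionRing B] [Algebra K B] {Γ : Type*} [LinearOrderedCommGroupWithZero Γ]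
    {v : Valuation B Γ} {π : B} (hv : IsIntegerValuation K v π) (D : Vertex K B) (t : ℕ) :
    (∀ I : Ideal D.1, IsMaximalBilateral I ↔ I = maximalBilateral D.1) ∧
      IsAdmissible (closedBall D t) ∧
      (intersectionOrder (closedBall D t) : Set (Matrix (Fin 2) (Fin 2) B)) = bracket D.1 t := by
  obtain ⟨g, hg⟩ := hv.exists_eq_ord D.2
  obtain rfl : D = hv.vertex g := Subtype.ext hg
  refine ⟨fun I => ?_, hv.isAdmissible_closedBall g t, hv.intersectionOrder_closedBall g t⟩
  change IsMaximalBilateral I ↔ I = maximalBilateral (hv.ord g)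
  rw [hv.maximalBilateral_ord]
  exact IsIntegerValuation.isMaximalBilateral_iff

end BTTree

theorem mainTheorem6 {K : Type*} [Field K] [ValuativeRel K] [TopologicalSpace K]
    [IsNonarchimedeanLocalField K]
    {B : Type*} [DivisionRing B] [Algebra K B] [Algebra.IsCentral K B] [FiniteDimensional K B]
    (D : BTTree.Vertex K B) (t : ℕ) :
    -- `M_D` is the unique maximal bilateral ideal of `D`
    (∀ I : Ideal D.1, BTTree.IsMaximalBilateral I ↔ I = BTTree.maximalBilateral D.1) ∧
    BTTree.IsAdmissible (BTTree.closedBall D t) ∧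
    (BTTree.intersectionOrder (BTTree.closedBall D t) : Set (Matrix (Fin 2) (Fin 2) B)) =
      BTTree.bracket D.1 t := by
  obtain ⟨π, hv⟩ := BTTree.exists_isIntegerValuation K B
  exact BTTree.mainTheorem6_general hv D t
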